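/- Fix $T>0$. Let $S(x,t)$, $(x,t)\in\mathbb{R}^2$, be a real-valued centered Gaussian random field with almost surely continuous realizations and $\langle S(x,t)S(x',t')\rangle_S=C(x-x',t-t')$, normalized by $C(0,0)=1$, where $\langle\cdot\rangle_S$ is the average over the realizations of $S$. Assume that $C(x,t)=\int_{\mathbb{R}^2}e^{i(kx+\omega t)}\,\nu(dk,d\omega)$ for a spectral measure $\nu\ge 0$ on $\mathbb{R}^2$ (for instance $\nu=D(k,\omega)\,dk\,d\omega$ with a spectral density $D\ge 0$) such that: (1) for fixed $\omega$ the spectrum is absolutely continuous in $k$, i.e. $\nu$ is absolutely continuous with respect to $dk\,\rho(d\omega)$, where $\rho$ is the $\omega$-marginal of $\nu$; (2) $\int(1+|k|^{2m_1}+|\omega|^{2m_2})\,d\nu<\infty$ for some $m_1,m_2>2$. For a real $a$ let $B(a,T)$ be the set of continuous paths $x(\cdot):[0,T]\to\mathbb{R}$ with $x(T)=a$, and let $\mathbb{P}_W$ be the Wiener measure on $B(a,T)$, that is, the law of $\tau\mapsto a+\beta(T-\tau)$ for a standard Brownian motion $\beta$ with $\beta(0)=0$, independent of $S$. For $g>0$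 let $$\mathcal{E}(a,g)=\int_{B(a,T)}\exp\Big[g\int_0^T S(x(\tau),\tau)^2\,d\tau\Big]\,d\mathbb{P}_W[x(\cdot)]\in[0,+\infty],$$ which is the Feynman--Kac formula for $\psi(a,T)$, where $\partial_t\psi-\frac12\partial_x^2\psi=g\,S^2\psi$ and $\psi(\cdot,0)=1$. Define the critical coupling $g_c=\inf\{g>0:\langle\mathcal{E}(0,g)\rangle_S=+\infty\}\in[0,+\infty]$ (with $\inf\emptyset=+\infty$). For $x(\cdot)\in B(0,T)$ let $\hat T_{x(\cdot)}$ be the covariance operator of $t\mapsto S(x(t),t)$ on $L^2([0,T];\mathbb{R})$, $$(\hat T_{x(\cdot)}f)(t)=\int_0^T C(x(t)-x(t'),t-t')\,f(t')\,dt'.$$ Then each $\hat T_{x(\cdot)}$, $x(\cdot)\in B(0,T)$, has a largest eigenvalue $\mu_1[x(\cdot)]$, the supremum $\mu_{\max}=\sup_{x(\cdot)\in B(0,T)}\mu_1[x(\cdot)]$ is finite, and $$g_c=\frac{1}{2\mu_{\max}}.$$ -/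

import Mathlib

open MeasureTheory ProbabilityTheory Set
open scoped ENNReal NNReal

noncomputable section

namespace StochHeat

/-- The space-time correlation function `C` has the spectral measure `ν` on the plane of the pairs
`(k, ω)`, where `ν` satisfies the ergodicity and the smoothness condition. When `ν` has a density
`D` with respect to Lebesgue measure on the plane, `∫ p, F p ∂ν` is `∫∫ F(k, ω) D(k, ω) dk dω`. -/
structure HasSpectralMeasure (C : ℝ → ℝ → ℝ) (ν : Measure (ℝ × ℝ)) : Prop where
  /-- Fourier representation of `C`. -/
  fourier : ∀ x t : ℝ,
    (C x t : ℂ) = ∫ p : ℝ × ℝ, Complex.exp (Complex.I * (p.1 * x + p.2 * t : ℝ)) ∂ν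
  /-- Ergodicity: for (almost every) fixed `ω` the spectrum is absolutely continuous in `k`, that
  is, `ν` is of the form `D(k, ω) dk ρ(dω)`, with `ρ` its `ω`-marginal. -/
  ergodicity : ν ≪ (volume : Measure ℝ).prod (ν.map Prod.snd)
  /-- Smoothness: a moment condition of order above 4 in each variable. -/
  smoothness : ∃ m₁ m₂ : ℝ, 2 < m₁ ∧ 2 < m₂ ∧
    Integrable (fun p : ℝ × ℝ => 1 + |p.1| ^ (2 * m₁) + |p.2| ^ (2 * m₂)) ν

/-- `S` (with value `S x t ω` at the point `x`, the time `t` and the realization `ω`) is a centered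
Gaussian field with `⟨S(x,t) S(x',t')⟩ = C(x - x', t - t')`, normalized by `C(0,0) = 1`, and with
almost surely continuous realizations. -/
structure IsGaussianField {Ω : Type*} [MeasurableSpace Ω] (C : ℝ → ℝ → ℝ)
    (S : ℝ → ℝ → Ω → ℝ) (P : Measure Ω) : Prop where
  gaussian : IsGaussianProcess (fun p : ℝ × ℝ => S p.1 p.2) P
  mean : ∀ x t : ℝ, ∫ ω, S x t ω ∂P = 0
  covariance : ∀ x t x' t' : ℝ, ∫ ω, S x t ω * S x' t' ω ∂P = C (x - x') (t - t')
  normalized : C 0 0 = 1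
  continuous : ∀ᵐ ω ∂P, Continuous (fun p : ℝ × ℝ => S p.1 p.2 ω)

/-- The amplification `𝓔(x, g)`, for the realization `s` of the field: the Feynman-Kac integral of
`exp (g ∫₀ᵀ s(x(τ), τ)² dτ)` over the Brownian paths `x(·)` that end at `x` at time `T`. Such a path
is `τ ↦ x + B (T - τ)` where `B` is a standard Brownian motion on the probability space `(Ω', W)`,
started at `0`. The value `∞` is allowed. -/
def amplification {Ω' : Type*} [MeasurableSpace Ω'] (W : Measure Ω') (B : ℝ≥0 → Ω' → ℝ) (T : ℝ)
    (s : ℝ → ℝ → ℝ) (x g : ℝ) : ℝ≥0∞ :=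
  ∫⁻ ω', ENNReal.ofReal
    (Real.exp (g * ∫ τ in (0 : ℝ)..T, s (x + B (T - τ).toNNReal ω') τ ^ 2)) ∂W

/-- The average `⟨𝓔(0, g)⟩_S` over the realizations of the field. -/
def meanAmplification {Ω Ω' : Type*} [MeasurableSpace Ω] [MeasurableSpace Ω']
    (P : Measure Ω) (S : ℝ → ℝ → Ω → ℝ) (W : Measure Ω') (B : ℝ≥0 → Ω' → ℝ) (T g : ℝ) : ℝ≥0∞ :=
  ∫⁻ ω, amplification W B T (fun x t => S x t ω) 0 g ∂P

/-- The critical coupling `inf {g > 0 : ⟨𝓔(0, g)⟩_S = ∞}`, an element of `[0, ∞]`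
(`∞` for the empty set). -/
def criticalCoupling {Ω Ω' : Type*} [MeasurableSpace Ω] [MeasurableSpace Ω']
    (P : Measure Ω) (S : ℝ → ℝ → Ω → ℝ) (W : Measure Ω') (B : ℝ≥0 → Ω' → ℝ) (T : ℝ) : ℝ≥0∞ :=
  sInf (ENNReal.ofReal '' {g : ℝ | 0 < g ∧ meanAmplification P S W B T g = ∞})

/-- The continuous paths on `[0, T]` that end at `a` at time `T`. (The values of `x` outside
`[0, T]` play no role below.) -/
def pathsEndingAt (a T : ℝ) : Set (ℝ → ℝ) :=
  {x | ContinuousOn x (Icc 0 T) ∧ x T = a}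

/-- The covariance operator of the process `t ↦ S(x(t), t)` on `[0, T]`. -/
def covarianceOperator (C : ℝ → ℝ → ℝ) (T : ℝ) (x : ℝ → ℝ) (f : ℝ → ℝ) (t : ℝ) : ℝ :=
  ∫ t' in (0 : ℝ)..T, C (x t - x t') (t - t') * f t'

/-- The eigenvalues of the covariance operator acting on `L²([0, T]; ℝ)`. -/
def eigenvalues (C : ℝ → ℝ → ℝ) (T : ℝ) (x : ℝ → ℝ) : Set ℝ :=
  {μ | ∃ f : ℝ → ℝ, MemLp f 2 (volume.restrict (Icc 0 T)) ∧
    ¬ (∀ᵐ t ∂(volume.restrict (Icc 0 T)), f t = 0) ∧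
    ∀ᵐ t ∂(volume.restrict (Icc 0 T)), covarianceOperator C T x f t = μ * f t}

/-- The largest eigenvalue `μ₁[x(·)]`. -/
def topEigenvalue (C : ℝ → ℝ → ℝ) (T : ℝ) (x : ℝ → ℝ) : ℝ := sSup (eigenvalues C T x)

/-- `μ_max`, the supremum of `μ₁[x(·)]` over the continuous paths ending at `0` at time `T`. -/
def muMax (C : ℝ → ℝ → ℝ) (T : ℝ) : ℝ := sSup (topEigenvalue C T '' pathsEndingAt 0 T)

end StochHeat

end

namespace StochHeat

open Filter Topology

/-! ### Riemann sums of continuous vector-valued functions. -/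

section RiemannSums

variable {V : Type*} [NormedAddCommGroup V] [NormedSpace ℝ V]

/-! By Tonelli, the mean amplification is the Wiener average of `E exp(g ∫ S(x(τ), τ)² dτ)` with the
path `x` frozen. Along such a path the field is a curve `φ` in `L²(P)`. With `A u = ⟪φ ·, u⟫`
(`curveOp`), the covariance operator is `A A*`, which is compact and positive, so `μ₁[x] = ‖A‖²`
(`isGreatest_eigenvalues`). As `‖φ t‖ = 1`, this is at most `T`.

Below the threshold, fix `κ > μ_max` with `2gκ < 1`. Diagonalizing the covariance of a discretized
path bounds the exponential moment by `exp(gT / (1 - 2gκ))`, whatever the path and the mesh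
(`lintegral_exp_sum_sq_le`, `lintegral_exp_le`). The mean amplification is therefore finite.

Above the threshold, some path `x₀` has `2g μ₁[x₀] > 1`. Testing against a continuous eigenfunction,
Cauchy-Schwarz bounds the exponent below by a multiple of the square of one Gaussian variable whose
variance is too large for integrability (`lintegral_exp_eq_top`). The inequality involved is strict,
so the same test function works for all paths uniformly close to `x₀`
(`exists_tube_lintegral_exp_eq_top`), and Brownian motion stays in that tube with nonzero
probability (`measure_tube_ne_zero`). What happens exactly at the threshold does not affect the
infimum. -/

lemma norm_riemannSum_sub_integral_le [CompleteSpace V] {F : ℝ → V} (hF : Continuous F)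
    {T : ℝ} (hT : 0 < T) {n : ℕ} (hn : 0 < n) {ε : ℝ}
    (h : ∀ s ∈ Icc 0 T, ∀ t ∈ Icc 0 T, |s - t| ≤ T / n → ‖F s - F t‖ ≤ ε) :
    ‖(T / n) • ∑ i ∈ Finset.range n, F (i * (T / n)) - ∫ t in (0 : ℝ)..T, F t‖ ≤ T * ε := by
  have hn' : (0 : ℝ) < n := by exact_mod_cast hn
  have hd : 0 < T / n := by positivity
  set d := T / n with hd_def
  have hTd : n * d = T := by rw [hd_def]; field_simp
  have hsum : ∑ i ∈ Finset.range n, ∫ t in ((i : ℕ) * d)..((i + 1 : ℕ) * d), F t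
      = ∫ t in (0 : ℝ)..T, F t := by
    have := intervalIntegral.sum_integral_adjacent_intervals (f := F) (μ := volume)
      (a := fun i : ℕ => (i : ℝ) * d) (n := n) (fun k _ => hF.intervalIntegrable _ _)
    simpa [hTd] using this
  rw [← hsum, Finset.smul_sum, ← Finset.sum_sub_distrib]
  have hterm : ∀ i ∈ Finset.range n,
      ‖d • F (i * d) - ∫ t in ((i : ℕ) * d)..((i + 1 : ℕ) * d), F t‖ ≤ ε * d := by
    intro i hi
    have hi' : (i : ℝ) + 1 ≤ n := by exact_mod_cast Finset.mem_range.1 hi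
    have hle : (i : ℝ) * d ≤ (i + 1 : ℕ) * d := by
      push_cast; nlinarith
    have hlen : ((i + 1 : ℕ) : ℝ) * d - i * d = d := by push_cast; ring
    have hc : d • F (i * d) = ∫ _t in ((i : ℕ) * d)..((i + 1 : ℕ) * d), F (i * d) := by
      rw [intervalIntegral.integral_const, hlen]
    rw [hc, ← intervalIntegral.integral_sub (by simp) (hF.intervalIntegrable _ _)]
    have hb := intervalIntegral.norm_integral_le_of_norm_le_const (C := ε)
      (a := (i : ℝ) * d) (b := (i + 1 : ℕ) * d) (f := fun t => F (i * d) - F t) ?_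
    · rwa [hlen, abs_of_pos hd] at hb
    · intro t ht
      rw [uIoc_of_le hle] at ht
      have h0 : (0 : ℝ) ≤ i * d := by positivity
      have h1 : ((i + 1 : ℕ) : ℝ) * d ≤ T := by
        rw [← hTd]; push_cast; gcongr
      refine h _ ⟨h0, by linarith [ht.1, ht.2]⟩ _ ⟨by linarith [ht.1], by linarith [ht.2]⟩ ?_
      rw [abs_le]; constructor <;> linarith [ht.1, ht.2]
  calc _ ≤ ∑ i ∈ Finset.range n, ε * d := norm_sum_le_of_le _ hterm
    _ = T * ε := by rw [Finset.sum_const, Finset.card_range, nsmul_eq_mul, ← hTd]; ring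

lemma eventually_mesh_lt (T : ℝ) {δ : ℝ} (hδ : 0 < δ) : ∀ᶠ n : ℕ in atTop, T / n < δ :=
  (tendsto_const_div_atTop_nhds_zero_nat T).eventually_lt_const hδ

lemma tendsto_riemannSum [CompleteSpace V] {F : ℝ → V} (hF : Continuous F) {T : ℝ} (hT : 0 < T) :
    Tendsto (fun n : ℕ => (T / n) • ∑ i ∈ Finset.range n, F (i * (T / n))) atTop
      (𝓝 (∫ t in (0 : ℝ)..T, F t)) := by
  rw [Metric.tendsto_atTop']
  intro ε hε
  have huc := isCompact_Icc.uniformContinuousOn_of_continuous (hF.continuousOn (s := Icc 0 T))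
  obtain ⟨δ, hδ, h⟩ := Metric.uniformContinuousOn_iff_le.1 huc (ε / (2 * T)) (by positivity)
  obtain ⟨N, hN⟩ := eventually_atTop.1 (eventually_mesh_lt T hδ)
  refine ⟨N, fun n hn => ?_⟩
  rw [dist_eq_norm]
  refine (norm_riemannSum_sub_integral_le hF hT (by lia) (ε := ε / (2 * T)) ?_).trans_lt ?_
  · intro s hs t ht hst
    rw [← dist_eq_norm]
    exact h s hs t ht (by rw [Real.dist_eq]; linarith [hN n hn.le])
  · field_simp
    linarith

end RiemannSums

/-! ### Everywhere continuous, measurable versions of a process. -/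

section Modification

variable {Ω : Type*} [MeasurableSpace Ω] {P : Measure Ω}

/-- Set the process to zero off a measurable full set on which it is continuous and agrees with
measurable versions along a countable dense set. Every value is then a pointwise limit of measurable
values. Continuity for every `ω` gives the joint measurability that Tonelli needs. -/
lemma exists_continuous_modification {E : Type*} [TopologicalSpace E]
    [TopologicalSpace.SeparableSpace E] [FrechetUrysohnSpace E] {X : E → Ω → ℝ}
    (hX : ∀ p, AEMeasurable (X p) P) (hc : ∀ᵐ ω ∂P, Continuous fun p => X p ω) :
    ∃ Y : E → Ω → ℝ, (∀ p, Measurable (Y p)) ∧ (∀ ω, Continuous fun p => Y p ω) ∧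
      ∀ᵐ ω ∂P, ∀ p, Y p ω = X p ω := by
  classical
  obtain ⟨D, hDc, hDd⟩ := TopologicalSpace.exists_countable_dense E
  have hD : ∀ᵐ ω ∂P, ∀ d ∈ D, X d ω = (hX d).mk (X d) ω :=
    (ae_ball_iff hDc).2 fun d _ => (hX d).ae_eq_mk
  obtain ⟨G, hGP, hGm, hG⟩ := (hc.and hD).exists_measurable_mem
  refine ⟨fun p ω => G.indicator (X p) ω, fun p => ?_, fun ω => ?_, ?_⟩
  · obtain ⟨u, huD, hu⟩ := mem_closure_iff_seq_limit.1 (hDd p)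
    refine measurable_of_tendsto_metrizable (f := fun n => G.indicator (X (u n))) (fun n => ?_) ?_
    · have : G.indicator (X (u n)) = G.indicator ((hX (u n)).mk (X (u n))) :=
        indicator_congr fun ω hω => (hG ω hω).2 _ (huD n)
      rw [this]
      exact (hX (u n)).measurable_mk.indicator hGm
    · rw [tendsto_pi_nhds]
      intro ω
      by_cases hω : ω ∈ G
      · simpa [hω, Function.comp_def] using ((hG ω hω).1.tendsto p).comp hu
      · simp [hω]
  · by_cases hω : ω ∈ G
    · simpa [hω] using (hG ω hω).1
    · simpa [hω] using continuous_const
  · filter_upwards [hGP] with ω hω p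
    simp [hω]

end Modification

/-! ### Exponential moments of squares of Gaussian variables. -/

section GaussianSquares

/-- The exponential absorbs the Gaussian decay, so the integrand is at least a positive constant. -/
lemma lintegral_exp_sq_gaussianReal_eq_top {v : ℝ≥0} {g : ℝ} (h : 1 ≤ 2 * g * v) :
    ∫⁻ y, ENNReal.ofReal (Real.exp (g * y ^ 2)) ∂(gaussianReal 0 v) = ∞ := by
  have hv : v ≠ 0 := by rintro rfl; norm_num at h
  have hv' : (0 : ℝ) < v := by positivity
  rw [gaussianReal_of_var_ne_zero _ hv,
    lintegral_withDensity_eq_lintegral_mul _ (measurable_gaussianPDF 0 v) (by fun_prop)]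
  refine top_le_iff.1 ?_
  have hc : ENNReal.ofReal (√(2 * Real.pi * v))⁻¹ ≠ 0 := by
    simp only [ne_eq, ENNReal.ofReal_eq_zero, not_le]; positivity
  calc (∞ : ℝ≥0∞) = ∫⁻ _ : ℝ, ENNReal.ofReal (√(2 * Real.pi * v))⁻¹ := by
        rw [lintegral_const, Real.volume_univ, ENNReal.mul_top hc]
    _ ≤ _ := by
        refine lintegral_mono fun y => ?_
        rw [Pi.mul_apply, gaussianPDF_def, ← ENNReal.ofReal_mul (gaussianPDFReal_nonneg _ _ _),
          gaussianPDFReal_def]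
        refine ENNReal.ofReal_le_ofReal ?_
        simp only [sub_zero]
        rw [mul_assoc _ (Real.exp _), ← Real.exp_add]
        refine le_mul_of_one_le_right (by positivity) (Real.one_le_exp ?_)
        have : -y ^ 2 / (2 * v) + g * y ^ 2 = y ^ 2 * (2 * g * v - 1) / (2 * v) := by
          field_simp; ring
        rw [this]
        exact div_nonneg (mul_nonneg (sq_nonneg _) (by linarith)) (by positivity)

/-- For `v ≠ 0` the integral equals `(1 - 2gv)^(-1/2)`; write `(1 - 2gv)⁻¹ = 1 + 2gv / (1 - 2gv)`
and use `1 + z ≤ exp z`. Keeping the exponent linear in `v` lets a product of such bounds depend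
only on the sum of the variances. -/
lemma lintegral_exp_sq_gaussianReal_le {v : ℝ≥0} {g κ : ℝ} (hg : 0 ≤ g) (hv : v ≤ κ)
    (h : 2 * g * κ < 1) :
    ∫⁻ y, ENNReal.ofReal (Real.exp (g * y ^ 2)) ∂(gaussianReal 0 v) ≤
      ENNReal.ofReal (Real.exp (g * v / (1 - 2 * g * κ))) := by
  rcases eq_or_ne v 0 with rfl | hv0
  · simp
  have hv' : (0 : ℝ) < v := by positivity
  have hgv : 2 * g * v < 1 := lt_of_le_of_lt (by gcongr) h
  set b : ℝ := (1 - 2 * g * v) / (2 * v) with hb_def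
  have hb : 0 < b := div_pos (by linarith) (by positivity)
  rw [gaussianReal_of_var_ne_zero _ hv0,
    lintegral_withDensity_eq_lintegral_mul _ (measurable_gaussianPDF 0 v) (by fun_prop)]
  have hpt : ∀ y : ℝ, (gaussianPDF 0 v * fun y => ENNReal.ofReal (Real.exp (g * y ^ 2))) y =
      ENNReal.ofReal ((√(2 * Real.pi * v))⁻¹ * Real.exp (-b * y ^ 2)) := by
    intro y
    rw [Pi.mul_apply, gaussianPDF_def, ← ENNReal.ofReal_mul (gaussianPDFReal_nonneg _ _ _),
      gaussianPDFReal_def]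
    simp only [sub_zero]
    rw [mul_assoc, ← Real.exp_add]
    congr 3
    rw [hb_def]
    field_simp
    ring
  simp_rw [hpt]
  rw [← ofReal_integral_eq_lintegral_ofReal ((integrable_exp_neg_mul_sq hb).const_mul _)
    (Eventually.of_forall fun y => by positivity), integral_const_mul, integral_gaussian]
  refine ENNReal.ofReal_le_ofReal ?_
  rw [← Real.sqrt_inv, ← Real.sqrt_mul (by positivity)]
  have h1 : (2 * Real.pi * (v : ℝ))⁻¹ * (Real.pi / b) = (1 - 2 * g * v)⁻¹ := by
    rw [hb_def]
    have : 1 - 2 * g * (v : ℝ) ≠ 0 := by linarith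
    field_simp
  rw [h1, ← Real.sqrt_sq (Real.exp_pos _).le]
  refine Real.sqrt_le_sqrt ?_
  rw [← Real.exp_nat_mul]
  have h2 : (1 - 2 * g * (v : ℝ))⁻¹ = 2 * g * v / (1 - 2 * g * v) + 1 := by
    have : 1 - 2 * g * (v : ℝ) ≠ 0 := by linarith
    field_simp
    ring
  rw [h2]
  refine le_trans ?_ (Real.add_one_le_exp _)
  have : 2 * g * v / (1 - 2 * g * v) ≤ 2 * g * v / (1 - 2 * g * κ) := by
    refine div_le_div_of_nonneg_left (by positivity) (by linarith) ?_
    have : 2 * g * v ≤ 2 * g * κ := by gcongr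
    linarith
  have h3 : ((2 : ℕ) : ℝ) * (g * v / (1 - 2 * g * κ)) = 2 * g * v / (1 - 2 * g * κ) := by
    push_cast; ring
  rw [h3]
  gcongr

variable {Ω : Type*} [MeasurableSpace Ω] {P : Measure Ω}

/-- Coordinates in an orthonormal eigenbasis of the covariance matrix are jointly Gaussian and
uncorrelated, hence independent, and the integral factors. The bound sees only `κ` and the trace of
the covariance, not the number of variables, so it survives refinement of the mesh. -/
lemma lintegral_exp_sum_sq_le {ι : Type*} [Fintype ι] {X : ι → Ω → ℝ}
    (hX : HasGaussianLaw (fun ω i => X i ω) P) (hXm : ∀ i, Measurable (X i)) (h0 : ∀ i, ∫ ω, X i ω ∂P = 0) {g κ : ℝ}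
    (hg : 0 ≤ g) (hκ : 2 * g * κ < 1)
    (hvar : ∀ v : ι → ℝ, Var[fun ω => ∑ i, v i * X i ω; P] ≤ κ * ∑ i, v i ^ 2) :
    ∫⁻ ω, ENNReal.ofReal (Real.exp (g * ∑ i, X i ω ^ 2)) ∂P ≤
      ENNReal.ofReal (Real.exp (g * (∑ i, ∫ ω, X i ω ^ 2 ∂P) / (1 - 2 * g * κ))) := by
  classical
  have hP := hX.isProbabilityMeasure
  have hL2 : ∀ i, MemLp (X i) 2 P := fun i => (hX.eval i).memLp_two
  let Γ : Matrix ι ι ℝ := Matrix.of fun i j => cov[X i, X j; P]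
  have hΓ : Γ.IsHermitian := by
    ext i j
    simp [Γ, covariance_comm]
  let b := hΓ.eigenvectorBasis
  let Y : ι → Ω → ℝ := fun k ω => ∑ i, b k i * X i ω
  have hY : HasGaussianLaw (fun ω k => Y k ω) P := by
    have := hX.map (LinearMap.toContinuousLinearMap
      (Matrix.mulVecLin (Matrix.of fun k i => b k i)))
    convert! this using 1
  have hY0 : ∀ k, ∫ ω, Y k ω ∂P = 0 := fun k => by
    simp only [Y]
    rw [integral_finsetSum _ fun i _ => ((hX.eval i).integrable.const_mul _)]
    simp [integral_const_mul, h0]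
  have hcov : ∀ k l, k ≠ l → cov[Y k, Y l; P] = 0 := by
    intro k l hkl
    simp only [Y]
    rw [covariance_fun_sum_fun_sum (fun i => (hL2 i).const_mul _) (fun i => (hL2 i).const_mul _)]
    have h1 : ∀ i, ∑ j, cov[fun ω => b k i * X i ω, fun ω => b l j * X j ω; P]
        = b k i * (hΓ.eigenvalues l * b l i) := by
      intro i
      have := congrFun (hΓ.mulVec_eigenvectorBasis l) i
      simp only [Matrix.mulVec, dotProduct, Pi.smul_apply, smul_eq_mul] at this
      rw [← this, Finset.mul_sum]
      refine Finset.sum_congr rfl fun j _ => ?_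
      rw [covariance_const_mul_left, covariance_const_mul_right]
      simp only [Γ, Matrix.of_apply, b]
      ring
    simp_rw [h1]
    have h2 := b.orthonormal.2 hkl.symm
    simp only [PiLp.inner_apply, RCLike.inner_apply, conj_trivial] at h2
    calc _ = hΓ.eigenvalues l * ∑ i, b k i * b l i := by
          rw [Finset.mul_sum]; exact Finset.sum_congr rfl fun i _ => by ring
      _ = 0 := by rw [h2, mul_zero]
  have hind : iIndepFun Y P := hY.iIndepFun_of_covariance_eq_zero hcov
  have hsq : ∀ ω, ∑ i, X i ω ^ 2 = ∑ k, Y k ω ^ 2 := by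
    intro ω
    have h1 := b.sum_sq_norm_inner_right (WithLp.toLp 2 fun i => X i ω)
    rw [EuclideanSpace.norm_sq_eq] at h1
    simp only [PiLp.inner_apply, RCLike.inner_apply, conj_trivial, Real.norm_eq_abs,
      sq_abs] at h1
    rw [← h1]
    refine Finset.sum_congr rfl fun k _ => ?_
    simp only [Y]
    congr 1
    exact Finset.sum_congr rfl fun i _ => by ring
  have hYL2 : ∀ i, MemLp (Y i) 2 P := fun i => (hY.eval i).memLp_two
  have hYvar : ∀ k, Var[Y k; P] = ∫ ω, Y k ω ^ 2 ∂P := fun k =>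
    variance_of_integral_eq_zero (hYL2 k).aestronglyMeasurable.aemeasurable (hY0 k)
  have hYκ : ∀ k, Var[Y k; P] ≤ κ := by
    intro k
    refine (hvar fun i => b k i).trans ?_
    have := b.norm_eq_one k
    have h1 : ∑ i, b k i ^ 2 = 1 := by
      have h2 := EuclideanSpace.norm_sq_eq (b k)
      rw [this] at h2
      simpa using h2.symm
    rw [h1, mul_one]
  have hone : ∀ k, ∫⁻ ω, ENNReal.ofReal (Real.exp (g * Y k ω ^ 2)) ∂P ≤
      ENNReal.ofReal (Real.exp (g * (∫ ω, Y k ω ^ 2 ∂P) / (1 - 2 * g * κ))) := by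
    intro k
    have hmap := (hY.eval k).map_eq_gaussianReal
    have hcoe : ((Var[Y k; P].toNNReal : ℝ≥0) : ℝ) = Var[Y k; P] :=
      Real.coe_toNNReal _ (variance_nonneg _ _)
    have h1 := lintegral_exp_sq_gaussianReal_le (v := Var[Y k; P].toNNReal) hg
      (by rw [hcoe]; exact hYκ k) hκ
    rw [hcoe, hYvar] at h1
    rw [hYvar, hY0 k] at hmap
    rw [← hmap, lintegral_map' (by fun_prop) (hY.eval k).aemeasurable] at h1
    exact h1
  calc ∫⁻ ω, ENNReal.ofReal (Real.exp (g * ∑ i, X i ω ^ 2)) ∂P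
      = ∫⁻ ω, ∏ k, ENNReal.ofReal (Real.exp (g * Y k ω ^ 2)) ∂P := by
        refine lintegral_congr fun ω => ?_
        rw [hsq, Finset.mul_sum, Real.exp_sum,
          ENNReal.ofReal_prod_of_nonneg fun _ _ => (Real.exp_pos _).le]
    _ = ∏ k, ∫⁻ ω, ENNReal.ofReal (Real.exp (g * Y k ω ^ 2)) ∂P := by
        have hφ : Measurable fun y : ℝ => ENNReal.ofReal (Real.exp (g * y ^ 2)) := by fun_prop
        exact lintegral_prod_eq_prod_lintegral_of_indepFun _ _ (hind.comp _ fun _ => hφ)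
          fun k => hφ.comp (Finset.measurable_fun_sum _ fun i _ => (hXm i).const_mul _)
    _ ≤ ∏ k, ENNReal.ofReal (Real.exp (g * (∫ ω, Y k ω ^ 2 ∂P) / (1 - 2 * g * κ))) :=
        Finset.prod_le_prod' fun k _ => hone k
    _ = _ := by
        rw [← ENNReal.ofReal_prod_of_nonneg fun _ _ => (Real.exp_pos _).le, ← Real.exp_sum,
          ← Finset.sum_div, ← Finset.mul_sum]
        -- Invariance of the trace: the two sums of squares agree pointwise, hence so do their
        -- means.
        rw [← integral_finsetSum _ fun i _ => (hL2 i).integrable_sq,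
          ← integral_finsetSum _ fun i _ => (hYL2 i).integrable_sq]
        simp_rw [hsq]

end GaussianSquares

end StochHeat

/-! ### The operator attached to a curve in a Hilbert space, and its top eigenvalue. -/

noncomputable section

namespace StochHeat

open Filter Topology BoundedContinuousFunction ContinuousLinearMap
open scoped InnerProductSpace

variable {H : Type*} [NormedAddCommGroup H] [InnerProductSpace ℝ H]

/-- The map that sends `g` to the function `t ↦ ⟪φ t, g⟫`. -/
def innerCurve (φ : ℝ →ᵇ H) : H →L[ℝ] (ℝ →ᵇ ℝ) :=
  LinearMap.mkContinuous
    { toFun := fun g => BoundedContinuousFunction.ofNormedAddCommGroup (fun t => ⟪φ t, g⟫_ℝ)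
        (by fun_prop) (‖φ‖ * ‖g‖) fun t => (norm_inner_le_norm _ _).trans
          (mul_le_mul_of_nonneg_right (φ.norm_coe_le_norm t) (norm_nonneg _))
      map_add' := fun g h => by ext t; simp [inner_add_right]
      map_smul' := fun c g => by ext t; simp [inner_smul_right] } ‖φ‖ fun g =>
    BoundedContinuousFunction.norm_ofNormedAddCommGroup_le _ (by positivity) fun t =>
      (norm_inner_le_norm _ _).trans
        (mul_le_mul_of_nonneg_right (φ.norm_coe_le_norm t) (norm_nonneg _))

lemma innerCurve_apply (φ : ℝ →ᵇ H) (g : H) (t : ℝ) : innerCurve φ g t = ⟪φ t, g⟫_ℝ := rfl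

/-- The operator `g ↦ ⟪φ ·, g⟫` from `H` to `L²([0, T])`. -/
def curveOp (T : ℝ) (φ : ℝ →ᵇ H) : H →L[ℝ] Lp ℝ 2 (volume.restrict (Icc 0 T)) :=
  (BoundedContinuousFunction.toLp 2 (volume.restrict (Icc 0 T)) ℝ) ∘L innerCurve φ

variable {T : ℝ} {φ : ℝ →ᵇ H}

lemma coeFn_curveOp (T : ℝ) (φ : ℝ →ᵇ H) (g : H) :
    curveOp T φ g =ᵐ[volume.restrict (Icc 0 T)] fun t => ⟪φ t, g⟫_ℝ :=
  BoundedContinuousFunction.coeFn_toLp (𝕜 := ℝ) _ _ (innerCurve φ g)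

lemma setIntegral_Icc_eq_intervalIntegral {V : Type*} [NormedAddCommGroup V] [NormedSpace ℝ V]
    (hT : 0 ≤ T) (f : ℝ → V) : ∫ t in Icc 0 T, f t = ∫ t in (0 : ℝ)..T, f t := by
  rw [intervalIntegral.integral_of_le hT, integral_Icc_eq_integral_Ioc]

lemma norm_sq_curveOp (hT : 0 ≤ T) (g : H) :
    ‖curveOp T φ g‖ ^ 2 = ∫ t in (0 : ℝ)..T, ⟪φ t, g⟫_ℝ ^ 2 := by
  rw [← real_inner_self_eq_norm_sq, L2.inner_def, ← setIntegral_Icc_eq_intervalIntegral hT]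
  refine integral_congr_ae ?_
  filter_upwards [coeFn_curveOp T φ g] with t ht
  rw [ht, real_inner_self_eq_norm_sq, Real.norm_eq_abs, sq_abs]

lemma integrable_smul_curve (f : Lp ℝ 2 (volume.restrict (Icc 0 T))) :
    Integrable (fun t => f t • φ t) (volume.restrict (Icc 0 T)) :=
  ((Lp.memLp f).integrable one_le_two).smul_bdd ‖φ‖ φ.continuous.aestronglyMeasurable
    (Eventually.of_forall φ.norm_coe_le_norm)

/-- Arzelà-Ascoli: over the unit ball, the functions `⟪φ ·, g⟫` are bounded by `‖φ‖` and inherit the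
modulus of continuity of `φ`. -/
lemma isCompactOperator_curveOp (hT : 0 ≤ T) (φ : ℝ →ᵇ H) : IsCompactOperator (curveOp T φ) := by
  refine (isCompactOperator_iff_image_closedBall_subset_compact
    (curveOp T φ).toLinearMap one_pos).2 ?_
  let p : C(ℝ, Icc (0 : ℝ) T) := ⟨projIcc 0 T hT, continuous_projIcc⟩
  let i : C(Icc (0 : ℝ) T, ℝ) := ⟨Subtype.val, continuous_subtype_val⟩
  let A : Set (Icc (0 : ℝ) T →ᵇ ℝ) :=
    (fun g => (innerCurve φ g).compContinuous i) '' Metric.closedBall 0 1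
  have hA : IsCompact (closure A) := by
    refine BoundedContinuousFunction.arzela_ascoli (Metric.closedBall 0 ‖φ‖)
      (isCompact_closedBall _ _) A ?_ ?_
    · rintro _ t ⟨g, hg, rfl⟩
      rw [mem_closedBall_zero_iff] at hg ⊢
      refine (norm_inner_le_norm (𝕜 := ℝ) (φ t) g).trans ?_
      exact (mul_le_of_le_one_right (norm_nonneg _) hg).trans (φ.norm_coe_le_norm _)
    · intro t
      rw [Metric.equicontinuousAt_iff]
      intro ε hε
      have hφt : ContinuousAt (fun s : Icc (0 : ℝ) T => φ s) t :=
        (φ.continuous.comp continuous_subtype_val).continuousAt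
      obtain ⟨δ, hδ, h⟩ := Metric.continuousAt_iff.1 hφt ε hε
      refine ⟨δ, hδ, ?_⟩
      rintro s hs ⟨_, g, hg, rfl⟩
      rw [mem_closedBall_zero_iff] at hg
      have := h hs
      change dist (⟪φ t, g⟫_ℝ) (⟪φ s, g⟫_ℝ) < ε
      rw [dist_eq_norm, ← inner_sub_left]
      refine (norm_inner_le_norm (𝕜 := ℝ) _ g).trans_lt ?_
      refine (mul_le_of_le_one_right (norm_nonneg _) hg).trans_lt ?_
      rwa [← dist_eq_norm, dist_comm]
  -- Composition with the projection of the line onto `[0, T]` returns from the compact interval to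
  -- functions on `ℝ`, without change on `[0, T]`.
  refine ⟨_, hA.image (f := fun u : Icc (0 : ℝ) T →ᵇ ℝ =>
    BoundedContinuousFunction.toLp 2 (volume.restrict (Icc 0 T)) ℝ (u.compContinuous p)) ?_, ?_⟩
  · exact (ContinuousLinearMap.continuous _).comp (continuous_compContinuous p)
  · rintro _ ⟨g, hg, rfl⟩
    refine ⟨_, subset_closure ⟨g, hg, rfl⟩, ?_⟩
    refine Lp.ext ?_
    filter_upwards [coeFn_curveOp T φ g, BoundedContinuousFunction.coeFn_toLp (𝕜 := ℝ) (p := 2)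
      (volume.restrict (Icc 0 T)) (((innerCurve φ g).compContinuous i).compContinuous p),
      ae_restrict_mem measurableSet_Icc] with t h1 h2 ht
    rw [h2]
    change _ = curveOp T φ g t
    rw [h1]
    simp [p, i, innerCurve_apply, projIcc_of_mem hT ht]

variable [CompleteSpace H]

lemma adjoint_curveOp_apply (f : Lp ℝ 2 (volume.restrict (Icc 0 T))) :
    adjoint (curveOp T φ) f = ∫ t in Icc 0 T, f t • φ t := by
  refine ext_inner_right ℝ fun g => ?_
  rw [adjoint_inner_left, L2.inner_def, real_inner_comm, ← integral_inner
    (integrable_smul_curve f)]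
  refine integral_congr_ae ?_
  filter_upwards [coeFn_curveOp T φ g] with t ht
  rw [ht, inner_smul_right, real_inner_comm (φ t)]
  simp [mul_comm]

lemma coeFn_curveOp_adjoint (f : Lp ℝ 2 (volume.restrict (Icc 0 T))) :
    curveOp T φ (adjoint (curveOp T φ) f) =ᵐ[volume.restrict (Icc 0 T)]
      fun t => ∫ s in Icc 0 T, ⟪φ t, φ s⟫_ℝ * f s := by
  filter_upwards [coeFn_curveOp T φ (adjoint (curveOp T φ) f)] with t ht
  rw [ht, adjoint_curveOp_apply, ← integral_inner (integrable_smul_curve f)]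
  simp [inner_smul_right, mul_comm]

lemma eigenvalue_le_norm_sq {μ : ℝ} {f : Lp ℝ 2 (volume.restrict (Icc 0 T))} (hf : f ≠ 0)
    (h : curveOp T φ (adjoint (curveOp T φ) f) = μ • f) : μ ≤ ‖curveOp T φ‖ ^ 2 := by
  have h1 : μ * ‖f‖ ^ 2 = ‖adjoint (curveOp T φ) f‖ ^ 2 := by
    rw [← real_inner_self_eq_norm_sq, ← real_inner_self_eq_norm_sq, adjoint_inner_left, h,
      inner_smul_right]
  have h2 : ‖adjoint (curveOp T φ) f‖ ≤ ‖curveOp T φ‖ * ‖f‖ := by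
    simpa using (adjoint (curveOp T φ)).le_opNorm f
  have hf' : 0 < ‖f‖ ^ 2 := by positivity
  refine le_of_mul_le_mul_right ?_ hf'
  rw [h1, ← mul_pow]
  gcongr

/-- `A A*` is symmetric and positive, so its norm is the supremum of its Rayleigh quotient and lies
in the spectrum; by compactness, a nonzero spectral value is an eigenvalue. -/
lemma exists_eigenvector_norm_sq (hT : 0 ≤ T) (h0 : curveOp T φ ≠ 0) :
    ∃ f : Lp ℝ 2 (volume.restrict (Icc 0 T)), f ≠ 0 ∧
      curveOp T φ (adjoint (curveOp T φ) f) = ‖curveOp T φ‖ ^ 2 • f := by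
  set A := curveOp T φ with hA
  let K := A ∘L adjoint A
  have hKn : ‖K‖ = ‖A‖ ^ 2 := by
    have := norm_adjoint_comp_self (adjoint A)
    rw [adjoint_adjoint] at this
    rw [show ‖K‖ = _ from this, LinearIsometryEquiv.norm_map, sq]
  have hKc : IsCompactOperator K := (isCompactOperator_curveOp hT φ).comp_clm (adjoint A)
  have hK0 : 0 < ‖K‖ := by rw [hKn]; positivity
  have hnt : Nontrivial (Lp ℝ 2 (volume.restrict (Icc 0 T))) := by
    by_contra hn
    rw [not_nontrivial_iff_subsingleton] at hn
    exact h0 (ContinuousLinearMap.ext fun g => Subsingleton.elim _ _)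
  have hsym : K.IsSymmetric := fun u v => by
    change ⟪A (adjoint A u), v⟫_ℝ = ⟪u, A (adjoint A v)⟫_ℝ
    rw [← adjoint_inner_right, adjoint_inner_left]
  have hray : ∀ u, 0 ≤ K.rayleighQuotient u := fun u => by
    refine div_nonneg ?_ (sq_nonneg _)
    rw [reApplyInnerSelf_apply]
    change 0 ≤ RCLike.re ⟪A (adjoint A u), u⟫_ℝ
    rw [← adjoint_inner_right]
    simp
  have hspec : ‖K‖ ∈ spectrum ℝ K := by
    by_contra hn
    -- Were the norm in the resolvent set, the Rayleigh quotient would stay a fixed `ε` below it.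
    obtain ⟨ε, hε, h⟩ := K.rayleighQuotient_le_of_norm_mem_resolventSet
      (by simpa [spectrum] using hn)
    have h1 := norm_eq_iSup_rayleighQuotient K hsym
    have h2 : ⨆ u, |K.rayleighQuotient u| ≤ ‖K‖ - ε :=
      ciSup_le fun u => by rw [abs_of_nonneg (hray u)]; exact h u
    linarith
  have hev := (hKc.hasEigenvalue_iff_mem_spectrum hK0.ne').2 hspec
  obtain ⟨f, hf⟩ := hev.exists_hasEigenvector
  refine ⟨f, hf.2, ?_⟩
  rw [← hKn]
  exact hf.apply_eq_smul

omit [CompleteSpace H] in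
lemma curveOp_ne_zero (hT : 0 < T) (h0 : φ 0 ≠ 0) : curveOp T φ ≠ 0 := by
  intro h
  have h1 := coeFn_curveOp T φ (φ 0)
  rw [h] at h1
  have h2 : (fun t => ⟪φ t, φ 0⟫_ℝ) =ᵐ[volume.restrict (Icc 0 T)] fun _ => 0 := by
    filter_upwards [h1, Lp.coeFn_zero ℝ 2 (volume.restrict (Icc 0 T))] with t h3 h4
    rw [← h3]
    exact h4
  have h3 := Measure.eqOn_Icc_of_ae_eq _ hT.ne h2 (by fun_prop) (by fun_prop)
    (left_mem_Icc.2 hT.le)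
  exact h0 (inner_self_eq_zero.1 h3)

variable {C : ℝ → ℝ → ℝ} {x : ℝ → ℝ}

lemma covarianceOperator_ae_eq (hT : 0 ≤ T)
    (hφ : ∀ s ∈ Icc 0 T, ∀ t ∈ Icc 0 T, ⟪φ s, φ t⟫_ℝ = C (x s - x t) (s - t))
    {f : ℝ → ℝ} (hf : MemLp f 2 (volume.restrict (Icc 0 T))) :
    covarianceOperator C T x f =ᵐ[volume.restrict (Icc 0 T)]
      curveOp T φ (adjoint (curveOp T φ) (hf.toLp f)) := by
  filter_upwards [coeFn_curveOp_adjoint (φ := φ) (hf.toLp f),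
    ae_restrict_mem measurableSet_Icc] with t h1 ht
  rw [h1, covarianceOperator, ← setIntegral_Icc_eq_intervalIntegral hT]
  refine integral_congr_ae ?_
  filter_upwards [hf.coeFn_toLp, ae_restrict_mem measurableSet_Icc] with s h2 hs
  rw [h2, hφ t ht s hs]

/-- The hypothesis on inner products says that the covariance operator is `A A*` with `A = curveOp T
φ`. Its norm `‖A‖²` is attained as an eigenvalue, and no eigenvalue exceeds it. -/
lemma isGreatest_eigenvalues (hT : 0 < T) (h0 : φ 0 ≠ 0)
    (hφ : ∀ s ∈ Icc 0 T, ∀ t ∈ Icc 0 T, ⟪φ s, φ t⟫_ℝ = C (x s - x t) (s - t)) :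
    IsGreatest (eigenvalues C T x) (‖curveOp T φ‖ ^ 2) := by
  constructor
  · obtain ⟨f, hf0, hf⟩ := exists_eigenvector_norm_sq hT.le (curveOp_ne_zero hT h0)
    refine ⟨f, Lp.memLp f, fun h => hf0 ?_, ?_⟩
    · exact (Lp.eq_zero_iff_ae_eq_zero).2 h
    · have h1 := covarianceOperator_ae_eq hT.le hφ (Lp.memLp f)
      rw [Lp.toLp_coeFn, hf] at h1
      filter_upwards [h1, Lp.coeFn_smul (‖curveOp T φ‖ ^ 2) f] with t h2 h3
      rw [h2, h3]
      rfl
  · rintro μ ⟨f, hf, hf0, hfμ⟩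
    refine eigenvalue_le_norm_sq (f := hf.toLp f) (φ := φ) (fun h => hf0 ?_) ?_
    · have := (Lp.eq_zero_iff_ae_eq_zero).1 h
      filter_upwards [this, hf.coeFn_toLp] with t h1 h2
      rw [← h2, h1]
      rfl
    · refine Lp.ext ?_
      filter_upwards [covarianceOperator_ae_eq hT.le hφ hf, hfμ, hf.coeFn_toLp,
        Lp.coeFn_smul μ (hf.toLp f)] with t h1 h2 h3 h4
      rw [← h1, h2, h4, Pi.smul_apply, h3]
      rfl

end StochHeat

end

/-! ### Brownian motion stays near a given continuous path with nonzero probability. -/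

noncomputable section

namespace StochHeat

open Filter Topology

/-- The piecewise linear interpolation of the values `y i` at the points `i * d`. -/
def interpolate (d : ℝ≥0) (y : ℕ → ℝ) (t : ℝ≥0) : ℝ :=
  (1 - (t / d - ⌊t / d⌋₊ : ℝ)) * y ⌊t / d⌋₊ + (t / d - ⌊t / d⌋₊ : ℝ) * y (⌊t / d⌋₊ + 1)

variable {d : ℝ≥0} {y : ℕ → ℝ}

lemma floor_weight_mem (d t : ℝ≥0) : (t / d - ⌊t / d⌋₊ : ℝ) ∈ Icc (0 : ℝ) 1 := by
  have h1 : ((⌊t / d⌋₊ : ℝ≥0) : ℝ) ≤ ((t / d : ℝ≥0) : ℝ) :=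
    NNReal.coe_le_coe.2 (Nat.floor_le zero_le)
  have h2 : ((t / d : ℝ≥0) : ℝ) < ((⌊t / d⌋₊ + 1 : ℝ≥0) : ℝ) :=
    NNReal.coe_lt_coe.2 (Nat.lt_floor_add_one _)
  push_cast at h1 h2
  constructor <;> linarith

lemma floor_mul_le (hd : 0 < d) (t : ℝ≥0) : (⌊t / d⌋₊ : ℝ) * d ≤ t := by
  have h := (floor_weight_mem d t).1
  have hd' : (0 : ℝ) < d := hd
  rw [← le_div_iff₀ hd']
  linarith

lemma le_floor_add_one_mul (hd : 0 < d) (t : ℝ≥0) : (t : ℝ) ≤ (⌊t / d⌋₊ + 1) * d := by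
  have h := (floor_weight_mem d t).2
  have hd' : (0 : ℝ) < d := hd
  rw [← div_le_iff₀ hd']
  linarith

lemma interpolate_sub (y z : ℕ → ℝ) (t : ℝ≥0) :
    interpolate d (fun i => y i - z i) t = interpolate d y t - interpolate d z t := by
  simp only [interpolate]; ring

lemma abs_interpolate_le {t : ℝ≥0} {ε : ℝ} (h0 : |y ⌊t / d⌋₊| ≤ ε)
    (h1 : |y (⌊t / d⌋₊ + 1)| ≤ ε) : |interpolate d y t| ≤ ε := by
  obtain ⟨h2, h3⟩ := floor_weight_mem d t
  unfold interpolate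
  set θ : ℝ := t / d - ⌊t / d⌋₊
  calc _ ≤ |(1 - θ) * y ⌊t / d⌋₊| + |θ * y (⌊t / d⌋₊ + 1)| := abs_add_le _ _
    _ = (1 - θ) * |y ⌊t / d⌋₊| + θ * |y (⌊t / d⌋₊ + 1)| := by
        rw [abs_mul, abs_mul, abs_of_nonneg h2, abs_of_nonneg (by linarith : 0 ≤ 1 - θ)]
    _ ≤ (1 - θ) * ε + θ * ε := by gcongr
    _ = ε := by ring

lemma interpolate_const (c : ℝ) (t : ℝ≥0) : interpolate d (fun _ => c) t = c := by
  simp only [interpolate]; ring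

/-- The only kink of `t ↦ min t (j * d)` is at a grid point, so interpolation on the grid is exact.
As `min` is the Brownian covariance, this decorrelates the bridges from the grid values. -/
lemma interpolate_min (hd : 0 < d) (j : ℕ) (t : ℝ≥0) :
    interpolate d (fun i => min (i * d : ℝ) (j * d)) t = min (t : ℝ) (j * d) := by
  have hd' : (0 : ℝ) < d := hd
  have h1 := floor_mul_le hd t
  have h2 := le_floor_add_one_mul hd t
  simp only [interpolate]
  set i := ⌊t / d⌋₊ with hi
  rcases Nat.lt_or_ge i j with h | h
  · have h3 : ((i : ℝ) + 1) * d ≤ j * d := by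
      gcongr; exact_mod_cast h
    push_cast
    rw [min_eq_left h3, min_eq_left (by nlinarith), min_eq_left (h2.trans h3)]
    field_simp
    ring
  · have h3 : (j : ℝ) * d ≤ i * d := by
      gcongr
    push_cast
    rw [min_eq_right h3, min_eq_right (by nlinarith), min_eq_right (h3.trans h1)]
    ring

lemma eventually_interpolate_close {f : ℝ≥0 → ℝ} (hf : Continuous f) (T : ℝ≥0) {ε : ℝ}
    (hε : 0 < ε) : ∀ᶠ n : ℕ in atTop, ∀ t ≤ T,
      |f t - interpolate ((n : ℝ≥0)⁻¹) (fun i => f (i * (n : ℝ≥0)⁻¹)) t| ≤ ε := by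
  have huc := (isCompact_Icc (a := (0 : ℝ≥0)) (b := T + 1)).uniformContinuousOn_of_continuous
    hf.continuousOn
  obtain ⟨δ, hδ, h⟩ := Metric.uniformContinuousOn_iff_le.1 huc ε hε
  have hlim : ∀ᶠ n : ℕ in atTop, (1 : ℝ) / n < δ := eventually_mesh_lt 1 hδ
  filter_upwards [hlim, eventually_ge_atTop 1] with n hn hn1 t ht
  have hn0 : (0 : ℝ≥0) < n := by exact_mod_cast hn1
  set d : ℝ≥0 := (n : ℝ≥0)⁻¹ with hd_def
  have hd : 0 < d := by positivity
  have hd1 : d ≤ 1 := by rw [hd_def]; exact inv_le_one_of_one_le₀ (by exact_mod_cast hn1)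
  have hdδ : (d : ℝ) < δ := by rw [hd_def]; push_cast; rwa [one_div] at hn
  have h1 := floor_mul_le hd t
  have h2 := le_floor_add_one_mul hd t
  have hd1' : (d : ℝ) ≤ 1 := by exact_mod_cast hd1
  have ht' : (t : ℝ) ≤ T := by exact_mod_cast ht
  rw [← interpolate_const (d := d) (f t) t, ← interpolate_sub]
  have htm : t ∈ Icc (0 : ℝ≥0) (T + 1) := ⟨zero_le, ht.trans (le_add_of_nonneg_right zero_le)⟩
  refine abs_interpolate_le ?_ ?_
  · refine h t htm _ ⟨zero_le, ?_⟩ ?_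
    · rw [← NNReal.coe_le_coe]; push_cast; linarith
    · rw [NNReal.dist_eq]; push_cast; rw [abs_le]; constructor <;> nlinarith
  · refine h t htm _ ⟨zero_le, ?_⟩ ?_
    · rw [← NNReal.coe_le_coe]; push_cast; linarith
    · rw [NNReal.dist_eq]; push_cast; rw [abs_le]; constructor <;> nlinarith

variable {Ω : Type*} [MeasurableSpace Ω] {W : Measure Ω} {B : ℝ≥0 → Ω → ℝ}

/-- The grid increments are independent with nondegenerate Gaussian laws, so all of them can be
close to those of `f` at once. -/
lemma measure_grid_pos (hB : IsPreBrownianReal B W) (hBm : ∀ t, Measurable (B t)) (hd : 0 < d)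
    {f : ℝ≥0 → ℝ} (hf0 : f 0 = 0) (N : ℕ) {ε : ℝ} (hε : 0 < ε) :
    W {ω | ∀ j ≤ N, |B (j * d) ω - f (j * d)| ≤ ε} ≠ 0 := by
  set t : Fin (N + 1) → ℝ≥0 := fun i => (i : ℕ) * d with ht_def
  have htm : Monotone t := fun i j hij => by
    simp only [ht_def]; gcongr; exact_mod_cast hij
  have hind := hB.hasIndepIncrements N t htm
  -- Increment errors accumulate over at most `N` steps.
  set η : ℝ := ε / (N + 1) with hη_def
  have hη : 0 < η := by positivity
  let s : Fin N → Set ℝ := fun i =>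
    Metric.ball (f (t i.succ) - f (t i.castSucc)) η
  have hprod := hind.measure_inter_preimage_eq_mul Finset.univ (sets := s)
    fun i _ => Metric.isOpen_ball.measurableSet
  have hpos : ∀ i : Fin N,
      W ((fun ω => B (t i.succ) ω - B (t i.castSucc) ω) ⁻¹' s i) ≠ 0 := by
    intro i
    have hlaw := hB.hasLaw_sub (t i.succ) (t i.castSucc)
    have hm : W.map (B (t i.succ) - B (t i.castSucc)) (s i) ≠ 0 := by
      rw [hlaw.map_eq]
      intro h0
      have hv : nndist ((t i.succ : ℝ≥0) : ℝ) (t i.castSucc : ℝ≥0) ≠ 0 := by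
        rw [Ne, nndist_eq_zero]
        simp only [ht_def, Fin.val_succ, Fin.val_castSucc]
        push_cast
        have hd' : (0 : ℝ) < d := hd
        intro h; nlinarith
      have := gaussianReal_absolutelyContinuous' 0 hv h0
      exact (Metric.measure_ball_pos volume _ hη).ne' this
    rwa [Measure.map_apply ((hBm _).sub (hBm _)) Metric.isOpen_ball.measurableSet] at hm
  have hne : W (⋂ i ∈ Finset.univ,
      (fun ω => B (t (Fin.succ i)) ω - B (t i.castSucc) ω) ⁻¹' s i) ≠ 0 := by
    rw [hprod]
    exact Finset.prod_ne_zero_iff.2 fun i _ => hpos i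
  intro h0
  refine hne (measure_mono_null_ae ?_ h0)
  filter_upwards [hB.eval_zero_ae_eq_zero] with ω hω0 hω
  have hω' : ∀ i : Fin N, |B (t i.succ) ω - B (t i.castSucc) ω -
      (f (t i.succ) - f (t i.castSucc))| < η :=
    fun i => mem_iInter₂.1 hω i (Finset.mem_univ i)
  have key : ∀ j ≤ N, |B (j * d) ω - f (j * d)| ≤ j * η := by
    intro j
    induction j with
    | zero => intro _; simp [hω0, hf0]
    | succ j ih =>
      intro hj
      have h1 := ih (by lia)
      have h2 := hω' ⟨j, by lia⟩
      simp only [ht_def, Fin.val_succ, Fin.val_castSucc] at h2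
      have h3 : B ((j + 1 : ℕ) * d) ω - f ((j + 1 : ℕ) * d) = (B (j * d) ω - f (j * d)) +
          ((B ((j + 1 : ℕ) * d) ω - B (j * d) ω) - (f ((j + 1 : ℕ) * d) - f (j * d))) := by ring
      rw [h3]
      refine (abs_add_le _ _).trans ?_
      push_cast at h2 ⊢
      linarith
  intro j hj
  refine (key j hj).trans ?_
  have : (j : ℝ) ≤ N + 1 := by
    have : (j : ℝ) ≤ N := by exact_mod_cast hj
    linarith
  calc (j : ℝ) * η ≤ (N + 1) * η := by gcongr
    _ = ε := by rw [hη_def]; field_simp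

/-- Both families are linear in one Gaussian process, so vanishing cross-covariances give
independence. -/
lemma indepFun_bridge_grid (hB : IsPreBrownianReal B W) (hBm : ∀ t, Measurable (B t))
    (hd : 0 < d) :
    IndepFun (fun ω (t : ℝ≥0) => B t ω - interpolate d (fun i => B (i * d) ω) t)
      (fun ω (j : ℕ) => B (j * d) ω) W := by
  classical
  have hP := hB.isGaussianProcess.isProbabilityMeasure
  have hL2 : ∀ t, MemLp (B t) 2 W := fun t => (hB.isGaussianProcess.hasGaussianLaw_eval t).memLp_two
  refine IsGaussianProcess.indepFun_of_covariance_eq_zero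
    (X := fun (t : ℝ≥0) ω => B t ω - interpolate d (fun i => B (i * d) ω) t)
    (Y := fun (j : ℕ) ω => B (j * d) ω) ?_ ?_ ?_ ?_
  · refine hB.isGaussianProcess.of_isGaussianProcess ?_
    rintro (t | j)
    · refine ⟨{t, ⌊t / d⌋₊ * d, (⌊t / d⌋₊ + 1 : ℕ) * d},
        .proj ⟨t, by simp⟩ - ((1 - (t / d - ⌊t / d⌋₊ : ℝ)) • .proj ⟨⌊t / d⌋₊ * d, by simp⟩ +
          (t / d - ⌊t / d⌋₊ : ℝ) • .proj ⟨(⌊t / d⌋₊ + 1 : ℕ) * d, by simp⟩), fun ω => ?_⟩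
      simp [interpolate]
    · exact ⟨{j * d}, .proj ⟨j * d, by simp⟩, fun ω => by simp⟩
  · intro t
    simp only [interpolate]
    fun_prop
  · intro j
    exact (hBm _).aemeasurable
  · intro t j
    have hcov : ∀ i : ℕ, cov[B (i * d), B (j * d); W] = min (i * d : ℝ) (j * d) := fun i => by
      rw [hB.covariance_eval]; push_cast; rfl
    have hcov' : cov[B t, B (j * d); W] = min (t : ℝ) (j * d) := by
      rw [hB.covariance_eval]; push_cast; rfl
    have hm : MemLp (fun ω => interpolate d (fun i => B (i * d) ω) t) 2 W :=
      ((hL2 _).const_mul _).add ((hL2 _).const_mul _)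
    rw [covariance_fun_sub_left (hL2 _) hm (hL2 _)]
    simp only [interpolate]
    change _ - cov[(fun ω => _ * B _ ω) + (fun ω => _ * B _ ω), _; W] = 0
    rw [covariance_add_left ((hL2 _).const_mul _) ((hL2 _).const_mul _) (hL2 _),
      covariance_const_mul_left, covariance_const_mul_left]
    rw [hcov', hcov, hcov, ← interpolate_min hd j t]
    simp only [interpolate]
    ring

/-- Split the error in three: the path against its interpolation, the grid values against those of
`f`, and `f` against its interpolation. The last is small for fine meshes; the first two are
independent events, each of nonzero probability for a suitable mesh. -/
theorem measure_tube_ne_zero (hB : IsPreBrownianReal B W) (hBm : ∀ t, Measurable (B t))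
    (hBc : ∀ ω, Continuous fun t => B t ω) {f : ℝ≥0 → ℝ} (hf : Continuous f) (hf0 : f 0 = 0)
    (T : ℝ≥0) {ε : ℝ} (hε : 0 < ε) :
    W {ω | ∀ t ≤ T, |B t ω - f t| ≤ ε} ≠ 0 := by
  have hP := hB.isGaussianProcess.isProbabilityMeasure
  -- Testing only countably many times makes the bridge event measurable in the product space;
  -- continuity recovers all times.
  obtain ⟨D, hDc, hDd⟩ := TopologicalSpace.exists_countable_dense (Iic T)
  obtain ⟨n₀, hn₀⟩ := eventually_atTop.1
    ((eventually_interpolate_close hf T (by positivity : 0 < ε / 3)).and (eventually_ge_atTop 1))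
  let R : ℕ → ℝ≥0 → Ω → ℝ := fun n t ω =>
    B t ω - interpolate ((n : ℝ≥0)⁻¹) (fun i => B (i * (n : ℝ≥0)⁻¹) ω) t
  obtain ⟨n, hn, hRn⟩ : ∃ n ≥ n₀, W {ω | ∀ t ∈ D, |R n t ω| ≤ ε / 3} ≠ 0 := by
    -- Each continuous path is within `ε / 3` of its interpolation for fine meshes, so these events
    -- cover the whole space and cannot all be null.
    by_contra! hcon
    have h0 : W (⋃ n ∈ Ici n₀, {ω | ∀ t ∈ D, |R n t ω| ≤ ε / 3}) = 0 :=
      (measure_biUnion_null_iff (to_countable _)).2 fun n hn => hcon n hn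
    have huniv : (⋃ n ∈ Ici n₀, {ω | ∀ t ∈ D, |R n t ω| ≤ ε / 3}) = univ := by
      refine eq_univ_of_forall fun ω => ?_
      obtain ⟨n, h1, h2⟩ := ((eventually_interpolate_close (hBc ω) T
        (by positivity : 0 < ε / 3)).and (eventually_ge_atTop n₀)).exists
      exact mem_biUnion (x := n) h2 fun t _ => h1 t t.2
    rw [huniv, measure_univ] at h0
    exact one_ne_zero h0
  obtain ⟨hfn, hn1⟩ := hn₀ n hn
  set d : ℝ≥0 := (n : ℝ≥0)⁻¹ with hd_def
  have hd : 0 < d := by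
    have : (0 : ℝ≥0) < n := by exact_mod_cast hn1
    positivity
  -- Interpolation at a time up to `T` also uses the grid point to its right.
  let N : ℕ := ⌊T / d⌋₊ + 1
  have hgrid := measure_grid_pos hB hBm hd hf0 N (by positivity : 0 < ε / 3)
  have hind := (indepFun_bridge_grid hB hBm hd).measure_inter_preimage_eq_mul
    {u : ℝ≥0 → ℝ | ∀ t ∈ D, |u t| ≤ ε / 3} {y : ℕ → ℝ | ∀ j ≤ N, |y j - f (j * d)| ≤ ε / 3} ?_ ?_
  · intro h0
    have hpos : W ({ω | ∀ t ∈ D, |R n t ω| ≤ ε / 3} ∩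
        {ω | ∀ j ≤ N, |B (j * d) ω - f (j * d)| ≤ ε / 3}) ≠ 0 := by
      refine ne_of_eq_of_ne hind ?_
      exact mul_ne_zero hRn hgrid
    refine hpos (measure_mono_null ?_ h0)
    rintro ω ⟨hω1, hω2⟩
    have hclosed : IsClosed {t : Iic T | |B t ω - f t| ≤ ε} :=
      isClosed_le (by have := hBc ω; fun_prop) continuous_const
    have hsub : D ⊆ {t : Iic T | |B t ω - f t| ≤ ε} := by
      intro t ht
      have h1 := hω1 t ht
      have h2 := hfn t t.2
      have hle : ⌊(t : ℝ≥0) / d⌋₊ ≤ ⌊T / d⌋₊ := by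
        gcongr
        exact t.2
      have h3 : |interpolate d (fun i => B (i * d) ω - f (i * d)) t| ≤ ε / 3 :=
        abs_interpolate_le (hω2 _ (by lia)) (hω2 _ (by lia))
      rw [interpolate_sub] at h3
      simp only [R] at h1
      rw [← hd_def] at h1
      simp only [mem_ofPred_eq]
      rw [abs_le] at h1 h2 h3 ⊢
      constructor <;> linarith [h1.1, h1.2, h2.1, h2.2, h3.1, h3.2]
    have hall : {t : Iic T | |B t ω - f t| ≤ ε} = univ :=
      hclosed.closure_eq ▸ (hDd.mono hsub).closure_eq
    intro t ht
    exact (eq_univ_iff_forall.1 hall) ⟨t, ht⟩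
  · have : {u : ℝ≥0 → ℝ | ∀ t ∈ D, |u t| ≤ ε / 3} = ⋂ t ∈ D, {u | |u t| ≤ ε / 3} := by
      ext; simp
    rw [this]
    exact MeasurableSet.biInter hDc fun t _ =>
      measurableSet_le (by fun_prop) measurable_const
  · have : {y : ℕ → ℝ | ∀ j ≤ N, |y j - f (j * d)| ≤ ε / 3} =
        ⋂ j ∈ Iic N, {y | |y j - f (j * d)| ≤ ε / 3} := by
      ext; simp
    rw [this]
    exact MeasurableSet.biInter (to_countable _) fun t _ =>
      measurableSet_le (by fun_prop) measurable_const

end StochHeat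

end

/-! ### Discretization and near-extremal test functions for a curve; the field as a curve in
`L²(P)`. -/

noncomputable section

namespace StochHeat

open Filter Topology BoundedContinuousFunction ContinuousLinearMap
open scoped InnerProductSpace

section Curves

variable {H : Type*} [NormedAddCommGroup H] [InnerProductSpace ℝ H] {T : ℝ} {φ : ℝ →ᵇ H}

/-- The integral that the sum approximates is `‖A h‖² ≤ ‖A‖² ‖h‖²`. The Riemann error is also of
order `‖h‖²`, so one mesh serves all `h`, and the gap `κ - ‖A‖²` absorbs it. -/
lemma eventually_riemannSum_inner_sq_le (hT : 0 < T) {κ : ℝ} (hκ : ‖curveOp T φ‖ ^ 2 < κ) :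
    ∀ᶠ n : ℕ in atTop, ∀ h : H,
      (T / n) * ∑ i ∈ Finset.range n, ⟪φ (i * (T / n)), h⟫_ℝ ^ 2 ≤ κ * ‖h‖ ^ 2 := by
  set ε : ℝ := (κ - ‖curveOp T φ‖ ^ 2) / T with hε_def
  have hε : 0 < ε := div_pos (by linarith) hT
  have huc := isCompact_Icc.uniformContinuousOn_of_continuous
    (φ.continuous.continuousOn (s := Icc 0 T))
  obtain ⟨δ, hδ, hφ⟩ := Metric.uniformContinuousOn_iff_le.1 huc (ε / (2 * ‖φ‖ + 1))
    (by positivity)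
  filter_upwards [eventually_mesh_lt T hδ, eventually_gt_atTop 0] with n hn hn0 h
  have hF : Continuous fun t => ⟪φ t, h⟫_ℝ ^ 2 := by fun_prop
  have hR := norm_riemannSum_sub_integral_le hF hT hn0 (ε := ε * ‖h‖ ^ 2) ?_
  · rw [← norm_sq_curveOp hT.le, smul_eq_mul] at hR
    have h1 := (abs_le.1 hR).2
    have h2 : ‖curveOp T φ h‖ ^ 2 ≤ ‖curveOp T φ‖ ^ 2 * ‖h‖ ^ 2 := by
      rw [← mul_pow]
      gcongr
      exact (curveOp T φ).le_opNorm h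
    have h3 : T * (ε * ‖h‖ ^ 2) = (κ - ‖curveOp T φ‖ ^ 2) * ‖h‖ ^ 2 := by
      rw [hε_def]; field_simp
    linarith
  · intro s hs t ht hst
    have h1 := hφ s hs t ht (by rw [Real.dist_eq]; linarith)
    rw [dist_eq_norm, le_div_iff₀ (by positivity)] at h1
    have h2 : ⟪φ s, h⟫_ℝ ^ 2 - ⟪φ t, h⟫_ℝ ^ 2 = ⟪φ s - φ t, h⟫_ℝ * ⟪φ s + φ t, h⟫_ℝ := by
      rw [inner_sub_left, inner_add_left]; ring
    rw [h2, norm_mul]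
    have h3 : ‖φ s + φ t‖ ≤ 2 * ‖φ‖ + 1 := by
      have := norm_add_le (φ s) (φ t)
      linarith [φ.norm_coe_le_norm s, φ.norm_coe_le_norm t]
    calc _ ≤ (‖φ s - φ t‖ * ‖h‖) * (‖φ s + φ t‖ * ‖h‖) := by
          gcongr <;> exact norm_inner_le_norm _ _
      _ = (‖φ s - φ t‖ * ‖φ s + φ t‖) * ‖h‖ ^ 2 := by ring
      _ ≤ (‖φ s - φ t‖ * (2 * ‖φ‖ + 1)) * ‖h‖ ^ 2 := by gcongr
      _ ≤ ε * ‖h‖ ^ 2 := by gcongr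

/-- An operator and its adjoint have the same norm. This turns the bound on `∑ ⟪w i, h⟫²` into a
bound on the variances of linear combinations. -/
lemma norm_sq_sum_smul_le {ι : Type*} [Fintype ι] {w : ι → H} {κ : ℝ} (hκ : 0 ≤ κ)
    (hw : ∀ h : H, ∑ i, ⟪w i, h⟫_ℝ ^ 2 ≤ κ * ‖h‖ ^ 2) (v : ι → ℝ) :
    ‖∑ i, v i • w i‖ ^ 2 ≤ κ * ∑ i, v i ^ 2 := by
  set h := ∑ i, v i • w i with hh
  have h1 : ‖h‖ ^ 2 = ∑ i, v i * ⟪w i, h⟫_ℝ := by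
    rw [← real_inner_self_eq_norm_sq]
    nth_rewrite 1 [hh]
    simp [sum_inner, inner_smul_left]
  have h2 := Finset.sum_mul_sq_le_sq_mul_sq Finset.univ v fun i => ⟪w i, h⟫_ℝ
  rw [← h1] at h2
  have h3 : (∑ i, v i ^ 2) * ∑ i, ⟪w i, h⟫_ℝ ^ 2 ≤ (∑ i, v i ^ 2) * (κ * ‖h‖ ^ 2) :=
    mul_le_mul_of_nonneg_left (hw h) (Finset.sum_nonneg fun i _ => sq_nonneg _)
  rcases eq_or_ne h 0 with h0 | h0
  · rw [h0, norm_zero, zero_pow two_ne_zero]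
    exact mul_nonneg hκ (Finset.sum_nonneg fun i _ => sq_nonneg _)
  · have h4 : 0 < ‖h‖ ^ 2 := by positivity
    refine le_of_mul_le_mul_right ?_ h4
    nlinarith

variable [CompleteSpace H]

lemma exists_continuous_maximizer (hT : 0 < T) (h0 : curveOp T φ ≠ 0) {c : ℝ}
    (hc : 1 < c * ‖curveOp T φ‖ ^ 2) :
    ∃ f : ℝ → ℝ, Continuous f ∧ 0 < ∫ t in (0 : ℝ)..T, f t ^ 2 ∧
      ∫ t in (0 : ℝ)..T, f t ^ 2 < c * ‖∫ t in (0 : ℝ)..T, f t • φ t‖ ^ 2 := by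
  obtain ⟨u, hu0, hu⟩ := exists_eigenvector_norm_sq hT.le h0
  set A := curveOp T φ with hA
  have hA0 : 0 < ‖A‖ := by positivity
  have hu' : 0 < ‖u‖ := by positivity
  -- This represents `A A* u = ‖A‖² u`: a continuous version of the top eigenvector, up to scale.
  refine ⟨fun t => ⟪φ t, adjoint A u⟫_ℝ, by fun_prop, ?_⟩
  have h1 : ∫ t in (0 : ℝ)..T, ⟪φ t, adjoint A u⟫_ℝ ^ 2 = (‖A‖ ^ 2) ^ 2 * ‖u‖ ^ 2 := by
    rw [← norm_sq_curveOp hT.le, ← hA, hu, norm_smul, mul_pow]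
    simp
  have h2 : ∫ t in (0 : ℝ)..T, ⟪φ t, adjoint A u⟫_ℝ • φ t = ‖A‖ ^ 2 • adjoint A u := by
    rw [← setIntegral_Icc_eq_intervalIntegral hT.le]
    calc ∫ t in Icc 0 T, ⟪φ t, adjoint A u⟫_ℝ • φ t = adjoint A (A (adjoint A u)) := by
          rw [hA, adjoint_curveOp_apply (curveOp T φ (adjoint (curveOp T φ) u))]
          refine integral_congr_ae ?_
          filter_upwards [coeFn_curveOp T φ (adjoint (curveOp T φ) u)] with t ht
          rw [ht]
      _ = ‖A‖ ^ 2 • adjoint A u := by rw [hu, map_smul]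
  have h3 : ‖adjoint A u‖ ^ 2 = ‖A‖ ^ 2 * ‖u‖ ^ 2 := by
    rw [← real_inner_self_eq_norm_sq, adjoint_inner_left, hu, inner_smul_right,
      real_inner_self_eq_norm_sq]
  rw [h1, h2, norm_smul, mul_pow, h3]
  refine ⟨by positivity, ?_⟩
  simp only [norm_pow, norm_norm]
  have h4 : 0 < (‖A‖ ^ 2) ^ 2 * ‖u‖ ^ 2 := by positivity
  calc (‖A‖ ^ 2) ^ 2 * ‖u‖ ^ 2 = 1 * ((‖A‖ ^ 2) ^ 2 * ‖u‖ ^ 2) := (one_mul _).symm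
    _ < (c * ‖A‖ ^ 2) * ((‖A‖ ^ 2) ^ 2 * ‖u‖ ^ 2) := by gcongr
    _ = _ := by ring

end Curves

variable {Ω : Type*} [MeasurableSpace Ω] {P : Measure Ω} {C : ℝ → ℝ → ℝ} {S : ℝ → ℝ → Ω → ℝ}

/-- The value of the field at a point, as an element of `L²(P)`. -/
def fieldVec (hS : IsGaussianField C S P) (p : ℝ × ℝ) : Lp ℝ 2 P :=
  (hS.gaussian.hasGaussianLaw_eval p).memLp_two.toLp (S p.1 p.2)

lemma coeFn_fieldVec (hS : IsGaussianField C S P) (p : ℝ × ℝ) :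
    fieldVec hS p =ᵐ[P] S p.1 p.2 :=
  (hS.gaussian.hasGaussianLaw_eval p).memLp_two.coeFn_toLp

lemma inner_fieldVec (hS : IsGaussianField C S P) (p q : ℝ × ℝ) :
    ⟪fieldVec hS p, fieldVec hS q⟫_ℝ = C (p.1 - q.1) (p.2 - q.2) := by
  rw [L2.inner_def, ← hS.covariance]
  refine integral_congr_ae ?_
  filter_upwards [coeFn_fieldVec hS p, coeFn_fieldVec hS q] with ω h1 h2
  rw [h1, h2]
  simp [mul_comm]

lemma norm_fieldVec (hS : IsGaussianField C S P) (p : ℝ × ℝ) : ‖fieldVec hS p‖ = 1 := by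
  have h := inner_fieldVec hS p p
  rw [sub_self, sub_self, hS.normalized, real_inner_self_eq_norm_sq] at h
  exact (pow_eq_one_iff_of_nonneg (norm_nonneg _) two_ne_zero).1 h

lemma norm_sq_fieldVec_sub (hS : IsGaussianField C S P) (p q : ℝ × ℝ) :
    ‖fieldVec hS p - fieldVec hS q‖ ^ 2 = 2 - 2 * C (p.1 - q.1) (p.2 - q.2) := by
  rw [norm_sub_sq_real, norm_fieldVec, norm_fieldVec, inner_fieldVec]
  ring

lemma continuous_fieldVec (hS : IsGaussianField C S P)
    (hC : Continuous fun p : ℝ × ℝ => C p.1 p.2) : Continuous (fieldVec hS) := by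
  rw [continuous_iff_continuousAt]
  intro q
  rw [ContinuousAt, tendsto_iff_norm_sub_tendsto_zero]
  have h1 : Tendsto (fun p : ℝ × ℝ => √(2 - 2 * C (p.1 - q.1) (p.2 - q.2))) (𝓝 q) (𝓝 0) := by
    have h2 : Continuous fun p : ℝ × ℝ => √(2 - 2 * C (p.1 - q.1) (p.2 - q.2)) := by
      have : Continuous fun p : ℝ × ℝ => C (p.1 - q.1) (p.2 - q.2) :=
        hC.comp (f := fun p : ℝ × ℝ => (p.1 - q.1, p.2 - q.2)) (by fun_prop)
      fun_prop
    have h3 := h2.tendsto q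
    simpa [hS.normalized] using h3
  refine h1.congr fun p => ?_
  rw [← norm_sq_fieldVec_sub hS, Real.sqrt_sq (norm_nonneg _)]

/-- The curve `t ↦ S(x(t), t)` in `L²(P)`. -/
def fieldCurve (hS : IsGaussianField C S P) (hC : Continuous fun p : ℝ × ℝ => C p.1 p.2)
    (x : C(ℝ, ℝ)) : ℝ →ᵇ Lp ℝ 2 P :=
  BoundedContinuousFunction.ofNormedAddCommGroup (fun t => fieldVec hS (x t, t))
    ((continuous_fieldVec hS hC).comp (by fun_prop)) 1 fun _ => (norm_fieldVec hS _).le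

variable {hS : IsGaussianField C S P} {hC : Continuous fun p : ℝ × ℝ => C p.1 p.2}

lemma fieldCurve_apply (x : C(ℝ, ℝ)) (t : ℝ) : fieldCurve hS hC x t = fieldVec hS (x t, t) := rfl

lemma isGreatest_eigenvalues_fieldCurve {T : ℝ} (hT : 0 < T) {x : ℝ → ℝ} (x' : C(ℝ, ℝ))
    (hx : EqOn x x' (Icc 0 T)) :
    IsGreatest (eigenvalues C T x) (‖curveOp T (fieldCurve hS hC x')‖ ^ 2) := by
  refine isGreatest_eigenvalues hT ?_ fun s hs t ht => ?_
  · rw [← norm_pos_iff, fieldCurve_apply, norm_fieldVec]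
    exact one_pos
  · rw [fieldCurve_apply, fieldCurve_apply, inner_fieldVec, hx hs, hx ht]

lemma hasGaussianLaw_sum_field (hS : IsGaussianField C S P) {ι : Type*} [Fintype ι]
    (p : ι → ℝ × ℝ) (c : ι → ℝ) :
    HasGaussianLaw (fun ω i => c i * S (p i).1 (p i).2 ω) P := by
  classical
  let L : (Finset.univ.image p → ℝ) →L[ℝ] ι → ℝ :=
    { toFun := fun u i => c i * u ⟨p i, by simp⟩
      map_add' := fun u v => by ext; simp [mul_add]
      map_smul' := fun a u => by ext; simp; ring }
  exact (hS.gaussian.hasGaussianLaw (Finset.univ.image p)).map L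

lemma integral_sum_field (hS : IsGaussianField C S P) {ι : Type*} [Fintype ι]
    (p : ι → ℝ × ℝ) (c : ι → ℝ) : ∫ ω, ∑ i, c i * S (p i).1 (p i).2 ω ∂P = 0 := by
  rw [integral_finsetSum _ fun i _ =>
    (hS.gaussian.hasGaussianLaw_eval (p i)).integrable.const_mul (c i)]
  simp [integral_const_mul, hS.mean]

lemma variance_sum_field (hS : IsGaussianField C S P) {ι : Type*} [Fintype ι]
    (p : ι → ℝ × ℝ) (c : ι → ℝ) :
    Var[fun ω => ∑ i, c i * S (p i).1 (p i).2 ω; P] = ‖∑ i, c i • fieldVec hS (p i)‖ ^ 2 := by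
  have hP := hS.gaussian.isProbabilityMeasure
  have hG : HasGaussianLaw (fun ω => ∑ i, c i * S (p i).1 (p i).2 ω) P :=
    (hasGaussianLaw_sum_field hS p c).fun_sum
  rw [variance_of_integral_eq_zero hG.aemeasurable (integral_sum_field hS p c),
    ← real_inner_self_eq_norm_sq]
  rw [sum_inner]
  simp_rw [inner_sum, inner_smul_left, inner_smul_right, inner_fieldVec, ← hS.covariance]
  have hint : ∀ i j, Integrable (fun ω => S (p i).1 (p i).2 ω * S (p j).1 (p j).2 ω) P :=
    fun i j => (hS.gaussian.hasGaussianLaw_eval (p i)).memLp_two.integrable_mul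
      (hS.gaussian.hasGaussianLaw_eval (p j)).memLp_two
  have hsq : ∀ ω, (∑ i, c i * S (p i).1 (p i).2 ω) ^ 2 =
      ∑ i, ∑ j, c i * (c j * (S (p i).1 (p i).2 ω * S (p j).1 (p j).2 ω)) := fun ω => by
    rw [sq, Finset.sum_mul_sum]
    exact Finset.sum_congr rfl fun i _ => Finset.sum_congr rfl fun j _ => by ring
  simp_rw [hsq]
  rw [integral_finsetSum _ fun i _ => integrable_finsetSum _ fun j _ =>
    ((hint i j).const_mul _).const_mul _]
  refine Finset.sum_congr rfl fun i _ => ?_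
  rw [integral_finsetSum _ fun j _ => ((hint i j).const_mul _).const_mul _]
  simp [integral_const_mul]

end StochHeat

end

/-! ### Exponential moments of `∫ S(x(τ), τ)² dτ` along a fixed path. -/

noncomputable section

namespace StochHeat

open Filter Topology BoundedContinuousFunction
open scoped InnerProductSpace

lemma HasSpectralMeasure.continuous {C : ℝ → ℝ → ℝ} {ν : Measure (ℝ × ℝ)}
    (h : HasSpectralMeasure C ν) : Continuous fun p : ℝ × ℝ => C p.1 p.2 := by
  obtain ⟨m₁, m₂, -, -, hint⟩ := h.smoothness
  have hone : Integrable (fun _ : ℝ × ℝ => (1 : ℝ)) ν := by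
    refine hint.mono' aestronglyMeasurable_const (Eventually.of_forall fun p => ?_)
    have h1 : 0 ≤ |p.1| ^ (2 * m₁) := by positivity
    have h2 : 0 ≤ |p.2| ^ (2 * m₂) := by positivity
    rw [norm_one]
    linarith
  have hc : Continuous fun p : ℝ × ℝ => (C p.1 p.2 : ℂ) := by
    simp_rw [h.fourier]
    refine continuous_of_dominated (bound := fun _ => 1) (fun p => ?_) (fun p => ?_) hone ?_
    · exact Continuous.aestronglyMeasurable (by fun_prop)
    · refine Eventually.of_forall fun q => ?_
      rw [mul_comm, Complex.norm_exp_ofReal_mul_I]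
    · exact Eventually.of_forall fun q => by fun_prop
  exact (Complex.continuous_re.comp hc).congr fun p => by simp

variable {Ω : Type*} [MeasurableSpace Ω] {P : Measure Ω} {C : ℝ → ℝ → ℝ} {S : ℝ → ℝ → Ω → ℝ}
  {hS : IsGaussianField C S P} {hC : Continuous fun p : ℝ × ℝ => C p.1 p.2} {T : ℝ}

lemma integral_field_sq (hS : IsGaussianField C S P) (x t : ℝ) : ∫ ω, S x t ω ^ 2 ∂P = 1 := by
  have := hS.covariance x t x t
  simp_rw [sub_self, hS.normalized, ← sq] at this
  exact this

/-- Apply the finite-dimensional bound to the samples scaled by `√(T / n)`: their `n` variances `T /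
n` sum to `T`, whatever the path. -/
lemma lintegral_exp_riemannSum_le (hSm : ∀ x t, Measurable (S x t)) (hT : 0 < T) (x : C(ℝ, ℝ))
    {g κ : ℝ} (hg : 0 ≤ g) (hκ0 : 0 ≤ κ) (hκ : 2 * g * κ < 1) {n : ℕ} (hn : 0 < n)
    (h : ∀ u : Lp ℝ 2 P, (T / n) * ∑ i ∈ Finset.range n,
      ⟪fieldCurve hS hC x (i * (T / n)), u⟫_ℝ ^ 2 ≤ κ * ‖u‖ ^ 2) :
    ∫⁻ ω, ENNReal.ofReal (Real.exp (g * ((T / n) •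
      ∑ i ∈ Finset.range n, S (x (i * (T / n))) (i * (T / n)) ω ^ 2))) ∂P ≤
      ENNReal.ofReal (Real.exp (g * T / (1 - 2 * g * κ))) := by
  have hn' : (0 : ℝ) < n := by exact_mod_cast hn
  have hr : √(T / n) ^ 2 = T / n := Real.sq_sqrt (by positivity)
  set r := √(T / n) with hr_def
  set p : Fin n → ℝ × ℝ := fun i => (x (i * (T / n)), i * (T / n)) with hp
  have hX := hasGaussianLaw_sum_field hS p fun _ => r
  have h1 := lintegral_exp_sum_sq_le (X := fun i ω => r * S (p i).1 (p i).2 ω) hX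
    (fun i => (hSm _ _).const_mul _) (fun i => ?_) hg hκ fun v => ?_
  · convert h1 using 1
    · refine lintegral_congr fun ω => ?_
      rw [Finset.sum_range, smul_eq_mul, Finset.mul_sum]
      simp_rw [mul_pow, hr]
      rfl
    · simp_rw [mul_pow, integral_const_mul, integral_field_sq hS, hr]
      simp only [mul_one, Finset.sum_const, Finset.card_univ, Fintype.card_fin, nsmul_eq_mul]
      rw [mul_div_cancel₀ _ hn'.ne']
  · rw [integral_const_mul, hS.mean, mul_zero]
  · have h2 := variance_sum_field hS p fun i => v i * r
    simp_rw [mul_assoc] at h2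
    rw [h2]
    have h3 := norm_sq_sum_smul_le (w := fun i => r • fieldVec hS (p i)) hκ0 (fun u => ?_) v
    · simpa [smul_smul] using h3
    · refine le_trans (le_of_eq ?_) (h u)
      rw [Finset.sum_range, Finset.mul_sum]
      simp_rw [real_inner_smul_left, mul_pow, hr]
      rfl

/-- Fatou's lemma carries the mesh-independent bound to the integral. -/
lemma lintegral_exp_le (hSm : ∀ x t, Measurable (S x t))
    (hSc : ∀ ω, Continuous fun p : ℝ × ℝ => S p.1 p.2 ω) (hT : 0 < T) (x : C(ℝ, ℝ))
    {g κ : ℝ} (hg : 0 ≤ g) (hκ : 2 * g * κ < 1) (hxκ : ‖curveOp T (fieldCurve hS hC x)‖ ^ 2 < κ) :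
    ∫⁻ ω, ENNReal.ofReal (Real.exp (g * ∫ τ in (0 : ℝ)..T, S (x τ) τ ω ^ 2)) ∂P ≤
      ENNReal.ofReal (Real.exp (g * T / (1 - 2 * g * κ))) := by
  have hκ0 : 0 ≤ κ := (sq_nonneg _).trans hxκ.le
  let F : ℕ → Ω → ℝ≥0∞ := fun n ω => ENNReal.ofReal (Real.exp (g * ((T / n) •
      ∑ i ∈ Finset.range n, S (x (i * (T / n))) (i * (T / n)) ω ^ 2)))
  have hlim : ∀ ω, Tendsto (fun n => F n ω) atTop
      (𝓝 (ENNReal.ofReal (Real.exp (g * ∫ τ in (0 : ℝ)..T, S (x τ) τ ω ^ 2)))) := by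
    intro ω
    have hc : Continuous fun τ => S (x τ) τ ω ^ 2 :=
      ((hSc ω).comp (f := fun τ => (x τ, τ)) (by fun_prop)).pow 2
    refine (ENNReal.continuous_ofReal.tendsto _).comp ((Real.continuous_exp.tendsto _).comp ?_)
    exact (tendsto_riemannSum hc hT).const_mul g
  have hF : ∀ n, Measurable (F n) := fun n => by
    have : ∀ i : ℕ, Measurable (S (x (i * (T / n))) (i * (T / n))) := fun i => hSm _ _
    simp only [F, smul_eq_mul]
    fun_prop
  calc _ = ∫⁻ ω, liminf (fun n => F n ω) atTop ∂P :=
        lintegral_congr fun ω => (hlim ω).liminf_eq.symm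
    _ ≤ liminf (fun n => ∫⁻ ω, F n ω ∂P) atTop := lintegral_liminf_le hF
    _ ≤ _ := by
        refine (liminf_le_limsup).trans (limsup_le_of_le (h := ?_))
        filter_upwards [eventually_riemannSum_inner_sq_le hT hxκ, eventually_gt_atTop 0]
          with n h1 h2
        exact lintegral_exp_riemannSum_le hSm hT x hg hκ0 hκ h2 h1

/-- Riemann sums of the left side are centered Gaussian and converge pointwise, while the
corresponding vectors, whose squared norms are the variances, converge in `L²(P)`. Characteristic
functions identify the limit law. -/
lemma map_integral_field_eq_gaussianReal (hSm : ∀ x t, Measurable (S x t))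
    (hSc : ∀ ω, Continuous fun p : ℝ × ℝ => S p.1 p.2 ω) (hT : 0 < T) (x : C(ℝ, ℝ))
    {f : ℝ → ℝ} (hf : Continuous f) :
    (Measurable fun ω => ∫ t in (0 : ℝ)..T, f t * S (x t) t ω) ∧
    P.map (fun ω => ∫ t in (0 : ℝ)..T, f t * S (x t) t ω) =
      gaussianReal 0 (‖∫ t in (0 : ℝ)..T, f t • fieldCurve hS hC x t‖₊ ^ 2) := by
  have hP := hS.gaussian.isProbabilityMeasure
  set Y : Ω → ℝ := fun ω => ∫ t in (0 : ℝ)..T, f t * S (x t) t ω with hY_def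
  let Z : ℕ → Ω → ℝ := fun n ω => (T / n) •
    ∑ i ∈ Finset.range n, f (i * (T / n)) * S (x (i * (T / n))) (i * (T / n)) ω
  have hlim : ∀ ω, Tendsto (fun n => Z n ω) atTop (𝓝 (Y ω)) := fun ω => by
    have hc : Continuous fun τ => f τ * S (x τ) τ ω :=
      hf.mul ((hSc ω).comp (f := fun τ => (x τ, τ)) (by fun_prop))
    exact tendsto_riemannSum hc hT
  have hZm : ∀ n, Measurable (Z n) := fun n => by
    have : ∀ i : ℕ, Measurable (S (x (i * (T / n))) (i * (T / n))) := fun i => hSm _ _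
    simp only [Z, smul_eq_mul]
    fun_prop
  have hYm : Measurable Y := measurable_of_tendsto_metrizable hZm (tendsto_pi_nhds.2 hlim)
  refine ⟨hYm, ?_⟩
  let w : ℕ → Lp ℝ 2 P := fun n => (T / n) •
    ∑ i ∈ Finset.range n, f (i * (T / n)) • fieldCurve hS hC x (i * (T / n))
  have hw : Tendsto w atTop (𝓝 (∫ t in (0 : ℝ)..T, f t • fieldCurve hS hC x t)) :=
    tendsto_riemannSum (F := fun t => f t • fieldCurve hS hC x t) (by fun_prop) hT
  have hZlaw : ∀ n, P.map (Z n) = gaussianReal 0 (‖w n‖₊ ^ 2) := by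
    intro n
    let p : Fin n → ℝ × ℝ := fun i => (x (i * (T / n)), i * (T / n))
    let c : Fin n → ℝ := fun i => (T / n) * f (i * (T / n))
    have hZ : Z n = fun ω => ∑ i, c i * S (p i).1 (p i).2 ω := by
      ext ω
      simp only [Z]
      rw [Finset.sum_range, smul_eq_mul, Finset.mul_sum]
      exact Finset.sum_congr rfl fun i _ => by simp only [c, p]; ring
    have hwn : w n = ∑ i, c i • fieldVec hS (p i) := by
      simp only [w]
      rw [Finset.sum_range, Finset.smul_sum]
      exact Finset.sum_congr rfl fun i _ => by rw [smul_smul]; rfl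
    have hG : HasGaussianLaw (Z n) P := by
      rw [hZ]
      exact (hasGaussianLaw_sum_field hS p c).fun_sum
    rw [hG.map_eq_gaussianReal]
    congr 1
    · rw [hZ]; exact integral_sum_field hS p c
    · rw [hZ, variance_sum_field hS p c, ← hwn]
      ext
      simp
  have hprob : IsProbabilityMeasure (P.map Y) := Measure.isProbabilityMeasure_map hYm.aemeasurable
  refine Measure.ext_of_charFun ?_
  ext u
  have h1 : Tendsto (fun n => charFun (P.map (Z n)) u) atTop (𝓝 (charFun (P.map Y) u)) := by
    simp_rw [charFun_apply_real]
    have hmap : ∀ V : Ω → ℝ, Measurable V → ∫ y, Complex.exp (u * y * Complex.I) ∂(P.map V) =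
        ∫ ω, Complex.exp (u * V ω * Complex.I) ∂P := fun V hV =>
      integral_map hV.aemeasurable (Continuous.aestronglyMeasurable (by fun_prop))
    simp_rw [hmap _ hYm, fun n => hmap _ (hZm n)]
    refine tendsto_integral_of_dominated_convergence (fun _ => 1) (fun n => ?_)
      (integrable_const _) (fun n => ?_) ?_
    · have := hZm n
      exact Measurable.aestronglyMeasurable (by fun_prop)
    · refine Eventually.of_forall fun ω => ?_
      rw [← Complex.ofReal_mul, Complex.norm_exp_ofReal_mul_I]
    · refine Eventually.of_forall fun ω => ?_
      have hc : Continuous fun y : ℝ => Complex.exp (u * y * Complex.I) := by fun_prop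
      exact (hc.tendsto _).comp (hlim ω)
  refine tendsto_nhds_unique h1 ?_
  simp_rw [hZlaw, charFun_gaussianReal]
  have hc : Continuous fun v : Lp ℝ 2 P =>
      Complex.exp (u * (0 : ℝ) * Complex.I - ((‖v‖₊ ^ 2 : ℝ≥0) : ℝ) * u ^ 2 / 2) := by
    push_cast
    fun_prop
  exact (hc.tendsto _).comp hw

lemma sq_integral_mul_le (hT : 0 ≤ T) {f s : ℝ → ℝ} (hf : Continuous f) (hs : Continuous s)
    (hf0 : 0 < ∫ t in (0 : ℝ)..T, f t ^ 2) :
    (∫ t in (0 : ℝ)..T, f t * s t) ^ 2 ≤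
      (∫ t in (0 : ℝ)..T, f t ^ 2) * ∫ t in (0 : ℝ)..T, s t ^ 2 := by
  set F := ∫ t in (0 : ℝ)..T, f t ^ 2
  set Y := ∫ t in (0 : ℝ)..T, f t * s t with hY
  set Q := ∫ t in (0 : ℝ)..T, s t ^ 2 with hQ
  have h1 : 0 ≤ ∫ t in (0 : ℝ)..T, (Y * f t - F * s t) ^ 2 :=
    intervalIntegral.integral_nonneg hT fun t _ => sq_nonneg _
  have h2 : ∫ t in (0 : ℝ)..T, (Y * f t - F * s t) ^ 2 = Y ^ 2 * F - 2 * Y * F * Y + F ^ 2 * Q := by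
    have h3 : ∀ t, (Y * f t - F * s t) ^ 2 =
        Y ^ 2 * f t ^ 2 - 2 * Y * F * (f t * s t) + F ^ 2 * s t ^ 2 := fun t => by ring
    simp_rw [h3]
    rw [intervalIntegral.integral_add, intervalIntegral.integral_sub,
      intervalIntegral.integral_const_mul, intervalIntegral.integral_const_mul,
      intervalIntegral.integral_const_mul]
    all_goals exact Continuous.intervalIntegrable (by fun_prop) _ _
  rw [h2] at h1
  have h4 : 0 ≤ F * (F * Q - Y ^ 2) := by linarith
  linarith [nonneg_of_mul_nonneg_right h4 hf0]

/-- With `Y = ∫ f S` and `F = ∫ f²`, Cauchy-Schwarz gives `∫ S² ≥ Y² / F`; the hypothesis says that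
the Gaussian variable `Y` has variance at least `F / (2g)`. -/
lemma lintegral_exp_eq_top (hSm : ∀ x t, Measurable (S x t))
    (hSc : ∀ ω, Continuous fun p : ℝ × ℝ => S p.1 p.2 ω) (hT : 0 < T) (x : C(ℝ, ℝ))
    {g : ℝ} (hg : 0 ≤ g) {f : ℝ → ℝ} (hf : Continuous f) (hf0 : 0 < ∫ t in (0 : ℝ)..T, f t ^ 2)
    (h : ∫ t in (0 : ℝ)..T, f t ^ 2 ≤
      2 * g * ‖∫ t in (0 : ℝ)..T, f t • fieldCurve hS hC x t‖ ^ 2) :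
    ∫⁻ ω, ENNReal.ofReal (Real.exp (g * ∫ τ in (0 : ℝ)..T, S (x τ) τ ω ^ 2)) ∂P = ∞ := by
  obtain ⟨hYm, hY⟩ := map_integral_field_eq_gaussianReal (hS := hS) (hC := hC) hSm hSc hT x hf
  set F := ∫ t in (0 : ℝ)..T, f t ^ 2
  have h1 := lintegral_exp_sq_gaussianReal_eq_top
    (v := ‖∫ t in (0 : ℝ)..T, f t • fieldCurve hS hC x t‖₊ ^ 2) (g := g / F) (by
      push_cast
      rw [show ∀ a : ℝ, 2 * (g / F) * a = (2 * g * a) / F from fun a => by ring,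
        one_le_div hf0]
      exact h)
  rw [← hY, lintegral_map (by fun_prop) hYm] at h1
  refine top_le_iff.1 (h1.symm.le.trans (lintegral_mono fun ω => ?_))
  refine ENNReal.ofReal_le_ofReal (Real.exp_le_exp.2 ?_)
  have hc : Continuous fun t => S (x t) t ω := (hSc ω).comp (f := fun τ => (x τ, τ)) (by fun_prop)
  have h2 := sq_integral_mul_le hT.le hf hc hf0
  calc _ = g * ((∫ t in (0 : ℝ)..T, f t * S (x t) t ω) ^ 2 / F) := by ring
    _ ≤ _ := by
      gcongr
      rw [div_le_iff₀ hf0]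
      linarith

lemma exists_tube_lintegral_exp_eq_top (hSm : ∀ x t, Measurable (S x t))
    (hSc : ∀ ω, Continuous fun p : ℝ × ℝ => S p.1 p.2 ω) (hT : 0 < T) (x₀ : C(ℝ, ℝ))
    {g : ℝ} (hg : 0 ≤ g) (h : 1 < 2 * g * ‖curveOp T (fieldCurve hS hC x₀)‖ ^ 2) :
    ∃ δ > 0, ∀ x : C(ℝ, ℝ), (∀ t ∈ Icc 0 T, |x t - x₀ t| ≤ δ) →
      ∫⁻ ω, ENNReal.ofReal (Real.exp (g * ∫ τ in (0 : ℝ)..T, S (x τ) τ ω ^ 2)) ∂P = ∞ := by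
  have hne : curveOp T (fieldCurve hS hC x₀) ≠ 0 := fun h0 => by
    rw [h0] at h
    norm_num at h
  obtain ⟨f, hf, hf0, hfm⟩ := exists_continuous_maximizer hT hne h
  let I : C(ℝ, ℝ) → Lp ℝ 2 P := fun x => ∫ t in (0 : ℝ)..T, f t • fieldCurve hS hC x t
  have hcont : Continuous fun v : Lp ℝ 2 P => 2 * g * ‖v‖ ^ 2 := by fun_prop
  have hnhds : ∀ᶠ v in 𝓝 (I x₀), ∫ t in (0 : ℝ)..T, f t ^ 2 < 2 * g * ‖v‖ ^ 2 :=
    hcont.continuousAt.eventually_const_lt hfm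
  obtain ⟨η, hη, hball⟩ := Metric.eventually_nhds_iff.1 hnhds
  obtain ⟨M, hM⟩ := isCompact_Icc.exists_bound_of_continuousOn (hf.continuousOn (s := Icc 0 T))
  have hM0 : 0 ≤ M := (norm_nonneg _).trans (hM 0 (left_mem_Icc.2 hT.le))
  -- Chosen so that `M * ε * T < η`; the `+ 1` covers `M = 0`.
  set ε := η / (M * T + 1) with hε_def
  have hε : 0 < ε := by positivity
  -- This is the `L²(P)` distance between the field values at two points a distance `y` apart at the
  -- same time, so one `δ` works for all times.
  have hC0 : Continuous fun y : ℝ => √(2 - 2 * C y 0) := by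
    have : Continuous fun y : ℝ => C y 0 := hC.comp (f := fun y : ℝ => (y, (0 : ℝ))) (by fun_prop)
    fun_prop
  have hlt : ∀ᶠ y in 𝓝 (0 : ℝ), √(2 - 2 * C y 0) < ε :=
    hC0.continuousAt.eventually_lt_const (by simpa [hS.normalized] using hε)
  obtain ⟨δ, hδ, hδε⟩ := Metric.eventually_nhds_iff.1 hlt
  refine ⟨δ / 2, by positivity, fun x hx => ?_⟩
  refine lintegral_exp_eq_top (hS := hS) (hC := hC) hSm hSc hT x hg hf hf0 (hball ?_).le
  have hsub : I x - I x₀ =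
      ∫ t in (0 : ℝ)..T, f t • (fieldCurve hS hC x t - fieldCurve hS hC x₀ t) := by
    simp only [I]
    rw [← intervalIntegral.integral_sub]
    · simp_rw [smul_sub]
    all_goals exact Continuous.intervalIntegrable (by fun_prop) _ _
  change dist (I x) (I x₀) < η
  rw [dist_eq_norm, hsub]
  have hb := intervalIntegral.norm_integral_le_of_norm_le_const (a := (0 : ℝ)) (b := T)
    (C := M * ε) (f := fun t => f t • (fieldCurve hS hC x t - fieldCurve hS hC x₀ t)) ?_
  · refine hb.trans_lt ?_
    rw [sub_zero, abs_of_pos hT, hε_def]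
    have : M * (η / (M * T + 1)) * T = η * ((M * T) / (M * T + 1)) := by ring
    rw [this]
    refine mul_lt_of_lt_one_right hη ?_
    rw [div_lt_one (by positivity)]
    linarith
  · intro t ht
    rw [uIoc_of_le hT.le] at ht
    have ht' : t ∈ Icc 0 T := ⟨ht.1.le, ht.2⟩
    rw [norm_smul]
    refine mul_le_mul (hM t ht') ?_ (norm_nonneg _) hM0
    rw [fieldCurve_apply, fieldCurve_apply, ← Real.sqrt_sq (norm_nonneg _), norm_sq_fieldVec_sub]
    simp only [sub_self]
    refine (hδε ?_).le
    rw [Real.dist_eq, sub_zero]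
    linarith [hx t ht']

end StochHeat

end

/-! ### Regular versions, Tonelli, and the infimum defining the critical coupling. -/

namespace StochHeat

open Filter Topology BoundedContinuousFunction

lemma IsGaussianField.congr {Ω : Type*} [MeasurableSpace Ω] {P : Measure Ω} {C : ℝ → ℝ → ℝ}
    {S S' : ℝ → ℝ → Ω → ℝ} (hS : IsGaussianField C S P) (h : ∀ᵐ ω ∂P, ∀ x t, S' x t ω = S x t ω) :
    IsGaussianField C S' P where
  gaussian := hS.gaussian.congr fun p => by
    filter_upwards [h] with ω hω
    rw [hω]
  mean x t := by
    rw [← hS.mean x t]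
    refine integral_congr_ae ?_
    filter_upwards [h] with ω hω
    rw [hω]
  covariance x t x' t' := by
    rw [← hS.covariance x t x' t']
    refine integral_congr_ae ?_
    filter_upwards [h] with ω hω
    rw [hω, hω]
  normalized := hS.normalized
  continuous := by
    filter_upwards [hS.continuous, h] with ω h1 h2
    simpa only [h2] using h1

lemma IsGaussianField.exists_regular {Ω : Type*} [MeasurableSpace Ω] {P : Measure Ω}
    {C : ℝ → ℝ → ℝ} {S : ℝ → ℝ → Ω → ℝ} (hS : IsGaussianField C S P) :
    ∃ S' : ℝ → ℝ → Ω → ℝ, IsGaussianField C S' P ∧ (∀ x t, Measurable (S' x t)) ∧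
      (∀ ω, Continuous fun p : ℝ × ℝ => S' p.1 p.2 ω) ∧
      ∀ᵐ ω ∂P, ∀ x t, S' x t ω = S x t ω := by
  obtain ⟨Y, hYm, hYc, hY⟩ := exists_continuous_modification
    (X := fun p : ℝ × ℝ => S p.1 p.2) (fun p => hS.gaussian.aemeasurable p) hS.continuous
  have hY' : ∀ᵐ ω ∂P, ∀ x t, Y (x, t) ω = S x t ω := by
    filter_upwards [hY] with ω hω x t using hω (x, t)
  exact ⟨fun x t => Y (x, t), hS.congr hY', fun x t => hYm _, hYc, hY'⟩

section

variable {Ω Ω' : Type*} [MeasurableSpace Ω] [MeasurableSpace Ω'] {P : Measure Ω}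
  [SFinite P] {W : Measure Ω'} [SFinite W] {T : ℝ} {S : ℝ → ℝ → Ω → ℝ} {B : ℝ≥0 → Ω' → ℝ}

lemma measurable_exp_integral (hT : 0 ≤ T) (g : ℝ) (hSm : ∀ x t, Measurable (S x t))
    (hSc : ∀ ω, Continuous fun p : ℝ × ℝ => S p.1 p.2 ω) (hBm : ∀ t, Measurable (B t))
    (hBc : ∀ ω', Continuous fun t => B t ω') :
    Measurable fun q : Ω × Ω' => ENNReal.ofReal
      (Real.exp (g * ∫ τ in (0 : ℝ)..T, S (0 + B (T - τ).toNNReal q.2) τ q.1 ^ 2)) := by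
  have hS2 : Measurable fun r : (ℝ × ℝ) × Ω => S r.1.1 r.1.2 r.2 :=
    measurable_uncurry_of_continuous_of_measurable (u := fun (p : ℝ × ℝ) ω => S p.1 p.2 ω)
      hSc fun p => hSm _ _
  have hB2 : Measurable fun r : ℝ≥0 × Ω' => B r.1 r.2 :=
    measurable_uncurry_of_continuous_of_measurable (u := B) hBc hBm
  have hB3 : Measurable fun r : (Ω × Ω') × ℝ => B (T - r.2).toNNReal r.1.2 :=
    hB2.comp (f := fun r : (Ω × Ω') × ℝ => ((T - r.2).toNNReal, r.1.2)) (by fun_prop)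
  have hF : Measurable fun r : (Ω × Ω') × ℝ =>
      S (0 + B (T - r.2).toNNReal r.1.2) r.2 r.1.1 ^ 2 :=
    (hS2.comp (f := fun r : (Ω × Ω') × ℝ => ((0 + B (T - r.2).toNNReal r.1.2, r.2), r.1.1))
      (by fun_prop)).pow_const 2
  have hI := (hF.stronglyMeasurable.integral_prod_right' (ν := volume.restrict (Ioc 0 T))).measurable
  simp_rw [intervalIntegral.integral_of_le hT]
  fun_prop

omit [SFinite P] [SFinite W] in
lemma meanAmplification_congr {S' : ℝ → ℝ → Ω → ℝ} {B' : ℝ≥0 → Ω' → ℝ}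
    (hS : ∀ᵐ ω ∂P, ∀ x t, S' x t ω = S x t ω) (hB : ∀ᵐ ω' ∂W, ∀ t, B' t ω' = B t ω') (g : ℝ) :
    meanAmplification P S W B T g = meanAmplification P S' W B' T g := by
  refine lintegral_congr_ae ?_
  filter_upwards [hS] with ω hω
  refine lintegral_congr_ae ?_
  filter_upwards [hB] with ω' hω'
  simp only [hω, hω']

lemma meanAmplification_eq (hT : 0 ≤ T) (g : ℝ) (hSm : ∀ x t, Measurable (S x t))
    (hSc : ∀ ω, Continuous fun p : ℝ × ℝ => S p.1 p.2 ω) (hBm : ∀ t, Measurable (B t))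
    (hBc : ∀ ω', Continuous fun t => B t ω') :
    meanAmplification P S W B T g = ∫⁻ ω', ∫⁻ ω, ENNReal.ofReal
      (Real.exp (g * ∫ τ in (0 : ℝ)..T, S (0 + B (T - τ).toNNReal ω') τ ω ^ 2)) ∂P ∂W :=
  lintegral_lintegral_swap (measurable_exp_integral hT g hSm hSc hBm hBc).aemeasurable

end

lemma exists_continuousMap_eqOn {T : ℝ} (hT : 0 ≤ T) {x : ℝ → ℝ} (hx : ContinuousOn x (Icc 0 T)) :
    ∃ x' : C(ℝ, ℝ), EqOn x x' (Icc 0 T) :=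
  ⟨⟨IccExtend hT ((Icc 0 T).domRestrict x), (continuousOn_iff_continuous_domRestrict.1 hx).Icc_extend'⟩,
    fun _ ht => (IccExtend_of_mem hT ((Icc 0 T).domRestrict x) ht).symm⟩

lemma sInf_ofReal_image_eq {G : Set ℝ} {m : ℝ} (hm : 0 < m)
    (hlt : ∀ g, 0 < g → 2 * g * m < 1 → g ∉ G) (hgt : ∀ g, 0 < g → 1 < 2 * g * m → g ∈ G)
    (hG : ∀ g ∈ G, 0 < g) :
    sInf (ENNReal.ofReal '' G) = 1 / (2 * ENNReal.ofReal m) := by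
  have hcoe : 1 / (2 * ENNReal.ofReal m) = ENNReal.ofReal (1 / (2 * m)) := by
    rw [ENNReal.ofReal_div_of_pos (by positivity), ENNReal.ofReal_mul zero_le_two]
    simp
  rw [hcoe]
  refine le_antisymm (le_of_forall_gt fun c hc => ?_) (le_sInf ?_)
  · obtain ⟨r, -, hr1, hr2⟩ := ENNReal.lt_iff_exists_real_btwn.1 hc
    have hr : 1 / (2 * m) < r := (ENNReal.ofReal_lt_ofReal_iff_of_nonneg (by positivity)).1 hr1
    have hr0 : 0 < r := lt_trans (by positivity) hr
    have hr3 : 1 < 2 * r * m := by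
      rw [div_lt_iff₀ (by positivity)] at hr
      linarith
    exact (sInf_le (mem_image_of_mem _ (hgt r hr0 hr3))).trans_lt hr2
  · rintro _ ⟨g, hg, rfl⟩
    refine ENNReal.ofReal_le_ofReal ?_
    rw [div_le_iff₀ (by positivity)]
    by_contra! hcon
    exact hlt g (hG g hg) (by linarith) hg

end StochHeat

theorem proposition1 {Ω Ω' : Type*} [MeasurableSpace Ω] [MeasurableSpace Ω']
    (P : Measure Ω) [IsProbabilityMeasure P] (W : Measure Ω') [IsProbabilityMeasure W]
    (T : ℝ) (hT : 0 < T)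
    (C : ℝ → ℝ → ℝ) (ν : Measure (ℝ × ℝ)) (hC : StochHeat.HasSpectralMeasure C ν)
    (S : ℝ → ℝ → Ω → ℝ) (hS : StochHeat.IsGaussianField C S P)
    (B : ℝ≥0 → Ω' → ℝ) (hB : IsBrownianReal B W) :
    (∀ x ∈ StochHeat.pathsEndingAt 0 T,
      IsGreatest (StochHeat.eigenvalues C T x) (StochHeat.topEigenvalue C T x)) ∧
    IsLUB (StochHeat.topEigenvalue C T '' StochHeat.pathsEndingAt 0 T) (StochHeat.muMax C T) ∧
    StochHeat.criticalCoupling P S W B T = 1 / (2 * ENNReal.ofReal (StochHeat.muMax C T)) := by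
  open StochHeat in
  obtain ⟨S', hS', hSm, hSc, hSS'⟩ := hS.exists_regular
  obtain ⟨B', hBm, hBc, hBB'⟩ := exists_continuous_modification
    (fun t => hB.aemeasurable t) hB.cont
  have hB' : IsPreBrownianReal B' W := hB.toIsPreBrownianReal.congr fun t => by
    filter_upwards [hBB'] with ω' h using (h t).symm
  have hCc := hC.continuous
  have hgreat : ∀ (x : ℝ → ℝ) (x' : C(ℝ, ℝ)), EqOn x x' (Icc 0 T) →
      IsGreatest (eigenvalues C T x) (‖curveOp T (fieldCurve hS' hCc x')‖ ^ 2) :=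
    fun x x' h => isGreatest_eigenvalues_fieldCurve hT x' h
  have htop : ∀ (x : ℝ → ℝ) (x' : C(ℝ, ℝ)), EqOn x x' (Icc 0 T) →
      topEigenvalue C T x = ‖curveOp T (fieldCurve hS' hCc x')‖ ^ 2 :=
    fun x x' h => (hgreat x x' h).csSup_eq
  have hzero : (fun _ => 0 : ℝ → ℝ) ∈ pathsEndingAt 0 T := ⟨continuousOn_const, rfl⟩
  have hlub : IsLUB (topEigenvalue C T '' pathsEndingAt 0 T) (muMax C T) := by
    refine isLUB_csSup ⟨_, mem_image_of_mem _ hzero⟩ ⟨T, ?_⟩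
    rintro _ ⟨x, hx, rfl⟩
    obtain ⟨x', hx'⟩ := exists_continuousMap_eqOn hT.le hx.1
    rw [htop x x' hx']
    -- The curve lies on the unit sphere of `L²(P)`, so `∫ ⟪φ t, u⟫² dt ≤ T ‖u‖²`.
    have h1 : ‖curveOp T (fieldCurve hS' hCc x')‖ ≤ √T := by
      refine ContinuousLinearMap.opNorm_le_bound _ (Real.sqrt_nonneg _) fun u => ?_
      refine abs_le_of_sq_le_sq' ?_ (by positivity) |>.2
      rw [norm_sq_curveOp hT.le, mul_pow, Real.sq_sqrt hT.le]
      have h2 : ∀ t ∈ Icc 0 T, inner ℝ (fieldCurve hS' hCc x' t) u ^ 2 ≤ ‖u‖ ^ 2 := fun t _ => by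
        have h3 := abs_real_inner_le_norm (fieldCurve hS' hCc x' t) u
        rw [fieldCurve_apply, norm_fieldVec, one_mul] at h3
        rw [fieldCurve_apply]
        exact sq_le_sq' (abs_le.1 h3).1 (abs_le.1 h3).2
      have h4 := intervalIntegral.integral_mono_on (μ := volume) hT.le
        (Continuous.intervalIntegrable (by fun_prop) 0 T)
        (continuous_const.intervalIntegrable 0 T) h2
      rwa [intervalIntegral.integral_const, sub_zero, smul_eq_mul] at h4
    calc _ ≤ √T ^ 2 := by gcongr
      _ = T := Real.sq_sqrt hT.le
  refine ⟨fun x hx => ?_, hlub, ?_⟩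
  · obtain ⟨x', hx'⟩ := exists_continuousMap_eqOn hT.le hx.1
    rw [htop x x' hx']
    exact hgreat x x' hx'
  have hle : ∀ x : C(ℝ, ℝ), x T = 0 →
      ‖curveOp T (fieldCurve hS' hCc x)‖ ^ 2 ≤ muMax C T := fun x hx => by
    rw [← htop x x (fun _ _ => rfl)]
    exact hlub.1 (mem_image_of_mem _ ⟨x.continuous.continuousOn, hx⟩)
  have hpos : 0 < muMax C T := by
    refine lt_of_lt_of_le ?_ (hle (ContinuousMap.const ℝ 0) rfl)
    have hne : curveOp T (fieldCurve hS' hCc (ContinuousMap.const ℝ 0)) ≠ 0 := by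
      refine curveOp_ne_zero hT ?_
      rw [← norm_pos_iff, fieldCurve_apply, norm_fieldVec]
      exact one_pos
    positivity
  let X : Ω' → C(ℝ, ℝ) := fun ω' => ⟨fun τ => 0 + B' (T - τ).toNNReal ω', by
    have := hBc ω'
    fun_prop⟩
  have hmean : ∀ g, meanAmplification P S W B T g = ∫⁻ ω', ∫⁻ ω, ENNReal.ofReal
      (Real.exp (g * ∫ τ in (0 : ℝ)..T, S' (X ω' τ) τ ω ^ 2)) ∂P ∂W := fun g => by
    rw [meanAmplification_congr hSS' hBB', meanAmplification_eq hT.le g hSm hSc hBm hBc]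
    rfl
  refine sInf_ofReal_image_eq hpos (fun g hg hg1 hmem => ?_) (fun g hg hg1 => ⟨hg, ?_⟩)
    fun g hg => hg.1
  -- The strict room above `μ_max` absorbs the discretization error for every path.
  · obtain ⟨κ, hκ1, hκ2⟩ : ∃ κ, muMax C T < κ ∧ 2 * g * κ < 1 := by
      have h1 : muMax C T < 1 / (2 * g) := by
        rw [lt_div_iff₀ (by positivity)]
        linarith
      obtain ⟨κ, h2, h3⟩ := exists_between h1
      refine ⟨κ, h2, ?_⟩
      rw [lt_div_iff₀ (by positivity)] at h3
      linarith
    have h2 : meanAmplification P S W B T g ≤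
        ENNReal.ofReal (Real.exp (g * T / (1 - 2 * g * κ))) := by
      rw [hmean]
      calc _ ≤ ∫⁻ _ : Ω', ENNReal.ofReal (Real.exp (g * T / (1 - 2 * g * κ))) ∂W := by
            refine lintegral_mono_ae ?_
            -- Brownian motion starts at `0` almost surely, so the reversed path ends at `0` and
            -- `μ_max` applies to it.
            filter_upwards [hB'.eval_zero_ae_eq_zero] with ω' hω'
            refine lintegral_exp_le (hS := hS') (hC := hCc) hSm hSc hT (X ω') hg.le hκ2 ?_
            refine (hle (X ω') ?_).trans_lt hκ1
            simp [X, hω']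
        _ = _ := by simp
    exact absurd hmem.2 (ne_top_of_le_ne_top ENNReal.ofReal_ne_top h2)
  · obtain ⟨_, ⟨x, hx, rfl⟩, hxg, -⟩ := hlub.exists_between
      (show 1 / (2 * g) < muMax C T by rw [div_lt_iff₀ (by positivity)]; linarith)
    obtain ⟨x₀, hx₀⟩ := exists_continuousMap_eqOn hT.le hx.1
    rw [htop x x₀ hx₀, div_lt_iff₀ (by positivity)] at hxg
    obtain ⟨δ, hδ, htube⟩ := exists_tube_lintegral_exp_eq_top (hS := hS') (hC := hCc) hSm hSc hT x₀
      hg.le (by linarith)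
    -- The path is Brownian motion run backwards from time `T`, so the target is reversed; it starts
    -- at `0` because `x₀ T = 0`.
    have hW := measure_tube_ne_zero hB' hBm hBc (f := fun s => x₀ (T - s)) (by fun_prop)
      (by simp [← hx₀ (right_mem_Icc.2 hT.le), hx.2]) T.toNNReal hδ
    rw [hmean]
    refine lintegral_eq_top_of_measure_eq_top_ne_zero ?_ fun h0 => hW (measure_mono_null ?_ h0)
    · exact (measurable_exp_integral hT.le g hSm hSc hBm hBc).lintegral_prod_left'.aemeasurable
    · intro ω' hω'
      refine htube (X ω') fun t ht => ?_
      have h1 := hω' (T - t).toNNReal (Real.toNNReal_le_toNNReal (by linarith [ht.1]))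
      rw [Real.coe_toNNReal _ (by linarith [ht.2]), sub_sub_cancel] at h1
      simpa [X] using h1
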